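/- Let $d\ge 1$ and $b\ge 2$ be integers. Hilbert curve. For every $m\ge 0$ let all $2^{dm}$ dyadic subcubes of $[0,1]^d$ of side $2^{-m}$ be listed, each exactly once, as $C^m_0,\dots,C^m_{2^{dm}-1}$, in such a way that $C^m_0$ contains the origin, consecutive cubes $C^m_k,C^m_{k+1}$ share a $(d-1)$-dimensional face, and $C^{m+1}_{k}\subset C^m_{\lfloor k/2^d\rfloor}$ for all $k$. Let $H:[0,1]\to[0,1]^d$ be the limit of the corresponding recursive curves: $H(x)$ is the limit, as $m\to\infty$, of the centre of the cube $C^m_k$ with $k=\min(\lfloor 2^{dm}x\rfloor,2^{dm}-1)$ (for $d=1$ this is $H(x)=x$). The statement holds for every such Hilbert curve $H$. Scrambled van der Corput points. On a probability space let $\pi_w$, for $w$ ranging over all finite words over $\{0,\dots,b-1\}$ (including the empty word), be independent random permutations of $\{0,\dots,b-1\}$, each uniformly distributed over the $b!$ permutations. For $i\ge 1$ write $i-1=\sum_{j\ge1}a_{ij}b^{j-1}$ in base $b$ and put $x_i=\sum_{j\ge1}x_{ij}b^{-j}$ with $x_{ij}=\pi_{a_{i1}\dots a_{i,j-1}}(a_{ij})$.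 For $f:[0,1]^d\to\mathbb R$ and $n=b^m$ let $$\hat\mu_n=\frac1n\sum_{i=1}^n f(H(x_i)),\qquad \mu=\int_{[0,1]^d}f(X)\,dX .$$ Theorem. Let $f=g\cdot 1_\Omega$, where $g\in C^1([0,1]^d)$, $\Omega\subset[0,1]^d$, and the boundary $\partial\Omega$ (in $\mathbb R^d$) admits a $(d-1)$-dimensional Minkowski content, that is, the limit $\lim_{\epsilon\downarrow0}\lambda_d(\{x+y: x\in\partial\Omega,\ \|y\|\le\epsilon\})/(2\epsilon)$ exists and is finite, $\lambda_d$ being Lebesgue measure. Suppose that $$\sigma_\Omega^2=\int_\Omega\|\nabla g(X)\|^2\,dX>0 .$$ Then $\hat\mu_n$ is square integrable for every $n=b^m$, and for all sufficiently large $n=b^m$ $$\mathrm{Var}(\hat\mu_n)\ \ge\ \frac{\sigma_\Omega^2}{96}\,2^{-2/d-d}\,n^{-1-2/d}.$$ If moreover $d>2$, then $$\frac{\hat\mu_n-\mu}{\sqrt{\mathrm{Var}(\hat\mu_n)}}\longrightarrow N(0,1)\quad\text{in distribution as } n=b^m\to\infty .$$ -/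

import Mathlib

open MeasureTheory ProbabilityTheory Filter Topology

namespace HSFC

/-- The closed unit cube `[0,1]^d`. -/
def unitCube (d : ℕ) : Set (EuclideanSpace ℝ (Fin d)) :=
  {x | ∀ j, x j ∈ Set.Icc (0 : ℝ) 1}

/-! ### Hilbert's space filling curve -/

/-- The recursive discrete curves whose limit is a Hilbert curve in dimension `d`.

The curve of level `m` passes through all `2 ^ (d * m)` dyadic subcubes of `[0,1]^d` of side
`2 ^ (-m)`, each of them once. The `k`-th cube visited is the one whose lowest corner is
`2 ^ (-m) * cell m k`.
* `bijOn`: every subcube of level `m` is visited exactly once;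
* `nested`: the curve of level `m + 1` refines the curve of level `m`: the `k`-th cube of level `m`
  is replaced by its `2 ^ d` subcubes, visited at the consecutive times `2 ^ d * k + r`, `r < 2 ^ d`;
* `adjacent`: cubes visited consecutively share a facet;
* `start`: the curve starts in the corner `0`. -/
structure IsHilbertOrder (d : ℕ) (cell : ℕ → ℕ → Fin d → ℕ) : Prop where
  bijOn : ∀ m, Set.BijOn (cell m) (Set.Iio (2 ^ (d * m))) {c | ∀ j, c j < 2 ^ m}
  nested : ∀ m, ∀ k < 2 ^ (d * (m + 1)), ∀ j, cell (m + 1) k j / 2 = cell m (k / 2 ^ d) j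
  adjacent : ∀ m k, k + 1 < 2 ^ (d * m) → ∃ i,
    (cell m (k + 1) i = cell m k i + 1 ∨ cell m k i = cell m (k + 1) i + 1) ∧
      ∀ j ≠ i, cell m (k + 1) j = cell m k j
  start : ∀ m j, cell m 0 j = 0

/-- The position `k` of the interval `[k / 2 ^ (d * m), (k + 1) / 2 ^ (d * m))` that contains
`x ∈ [0,1)`; the right end point `x = 1` belongs to the last interval. -/
noncomputable def timeIndex (d m : ℕ) (x : ℝ) : ℕ :=
  min ⌊2 ^ (d * m) * x⌋₊ (2 ^ (d * m) - 1)

/-- The approximating curve of level `m`: at time `x` it is at the centre of the dyadic cube of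
level `m` visited at that time. -/
noncomputable def approxCurve (d : ℕ) (cell : ℕ → ℕ → Fin d → ℕ) (m : ℕ) (x : ℝ) :
    EuclideanSpace ℝ (Fin d) :=
  WithLp.toLp 2 fun j => ((cell m (timeIndex d m x) j : ℝ) + 1 / 2) / 2 ^ m

/-- The Hilbert curve `H : [0,1] → [0,1]^d`, the limit of the recursive curves. -/
noncomputable def hilbertCurve (d : ℕ) (cell : ℕ → ℕ → Fin d → ℕ) (x : ℝ) :
    EuclideanSpace ℝ (Fin d) :=
  limUnder atTop fun m => approxCurve d cell m x

theorem timeIndex_lt (d m : ℕ) (x : ℝ) : timeIndex d m x < 2 ^ (d * m) := by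
  have := Nat.two_pow_pos (d * m)
  unfold timeIndex
  omega

theorem timeIndex_succ (d m : ℕ) (x : ℝ) :
    timeIndex d (m + 1) x / 2 ^ d = timeIndex d m x := by
  have hd := Nat.two_pow_pos d
  have hm := Nat.two_pow_pos (d * m)
  have e : 2 ^ (d * (m + 1)) = 2 ^ (d * m) * 2 ^ d := by rw [← pow_add]; congr 1
  have h1 : ⌊(2 : ℝ) ^ (d * (m + 1)) * x⌋₊ / 2 ^ d = ⌊(2 : ℝ) ^ (d * m) * x⌋₊ := by
    rw [← Nat.floor_div_natCast]
    congr 1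
    have : (2 : ℝ) ^ (d * (m + 1)) = 2 ^ (d * m) * 2 ^ d := by exact_mod_cast e
    rw [this]
    push_cast
    field_simp
  have h2 : (2 ^ (d * (m + 1)) - 1) / 2 ^ d = 2 ^ (d * m) - 1 := by
    rw [e]
    obtain ⟨u, hu⟩ := Nat.exists_eq_add_of_lt hm
    rw [hu, Nat.div_eq_iff hd]
    simp only [zero_add, Nat.add_sub_cancel]
    rw [add_mul]
    omega
  unfold timeIndex
  rw [← h1, ← h2]
  rcases le_total ⌊(2 : ℝ) ^ (d * (m + 1)) * x⌋₊ (2 ^ (d * (m + 1)) - 1) with h | h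
  · rw [min_eq_left h, min_eq_left (Nat.div_le_div_right h)]
  · rw [min_eq_right h, min_eq_right (Nat.div_le_div_right h)]

/-- The approximating curves converge, so that the limit in `hilbertCurve` is a genuine one. -/
theorem tendsto_approxCurve {d : ℕ} {cell : ℕ → ℕ → Fin d → ℕ} (h : IsHilbertOrder d cell)
    (x : ℝ) : Tendsto (fun m => approxCurve d cell m x) atTop (𝓝 (hilbertCurve d cell x)) := by
  apply tendsto_nhds_limUnder
  have key (j : Fin d) : CauchySeq fun m => approxCurve d cell m x j := by
    refine cauchySeq_of_le_geometric (1 / 2) (1 / 4) (by norm_num) fun m => ?_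
    have hn := h.nested m _ (timeIndex_lt d (m + 1) x) j
    rw [timeIndex_succ] at hn
    have h2 : cell (m + 1) (timeIndex d (m + 1) x) j = 2 * cell m (timeIndex d m x) j ∨
        cell (m + 1) (timeIndex d (m + 1) x) j = 2 * cell m (timeIndex d m x) j + 1 := by omega
    have hp : (0 : ℝ) < 2 ^ m := by positivity
    rw [Real.dist_eq]
    simp only [approxCurve]
    rcases h2 with h2 | h2 <;> rw [h2] <;> push_cast <;> rw [pow_succ, one_div_pow]
    · have : ((cell m (timeIndex d m x) j : ℝ) + 1 / 2) / 2 ^ m -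
          (2 * (cell m (timeIndex d m x) j : ℝ) + 1 / 2) / (2 ^ m * 2) = 1 / 4 * (1 / 2 ^ m) := by
        field_simp; ring
      rw [this, abs_of_pos (by positivity)]
    · have : ((cell m (timeIndex d m x) j : ℝ) + 1 / 2) / 2 ^ m -
          (2 * (cell m (timeIndex d m x) j : ℝ) + 1 + 1 / 2) / (2 ^ m * 2) =
            -(1 / 4 * (1 / 2 ^ m)) := by
        field_simp; ring
      rw [this, abs_neg, abs_of_pos (by positivity)]
  choose l hl using fun j => cauchySeq_tendsto_of_complete (key j)
  refine ⟨WithLp.toLp 2 l, ?_⟩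
  have := (PiLp.continuous_toLp 2 fun _ : Fin d => ℝ).tendsto l
  exact this.comp (tendsto_pi_nhds.2 hl)

/-! ### Hilbert orders exist: the Gray code construction -/

namespace GrayHilbert

/-- Bit `i` of the `k`-th word of the binary reflected Gray code. -/
def gray (k i : ℕ) : Bool := k.testBit i ^^ k.testBit (i + 1)

/-- The `k`-th vertex of the Hamiltonian path on the hypercube that runs from the vertex `e` to
its neighbour along the coordinate axis `a`. -/
def vertex {n : ℕ} (e : Fin (n + 1) → Bool) (a : Fin (n + 1)) (k : ℕ) : Fin (n + 1) → Bool :=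
  fun i => e i ^^ gray k (Equiv.swap a (Fin.last n) i : Fin (n + 1))

/-- The axis along which the curve inside the `k`-th subcube runs from its entry corner to its
exit corner. -/
def axis {n : ℕ} (a : Fin (n + 1)) (k : ℕ) : Fin (n + 1) :=
  Equiv.swap a (Fin.last n) (Fin.ofNat (n + 1) (padicValNat 2 (2 * ((k + 1) / 2))))

/-- The level-`m` curve that enters the cube at the corner `e` and leaves it at the neighbouring
corner along the axis `a`: the `2 ^ (n + 1)` subcubes are passed in Gray code order, and each of
them carries a copy of the curve of level `m - 1`, entered at its own corner along its own axis. -/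
def cellFrom (n : ℕ) : ℕ → (Fin (n + 1) → Bool) → Fin (n + 1) → ℕ → Fin (n + 1) → ℕ
  | 0, _, _, _ => fun _ => 0
  | m + 1, e, a, k => fun i =>
      (vertex e a (k / 2 ^ ((n + 1) * m)) i).toNat * 2 ^ m +
        cellFrom n m (vertex e a (2 * ((k / 2 ^ ((n + 1) * m) - 1) / 2)))
          (axis a (k / 2 ^ ((n + 1) * m))) (k % 2 ^ ((n + 1) * m)) i

theorem gray_zero (i : ℕ) : gray 0 i = false := by simp [gray]

theorem testBit_succ (k i : ℕ) : (k + 1).testBit i = (k.testBit i ^^ decide (2 ^ i ∣ k + 1)) := by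
  simp only [Nat.testBit_eq_decide_div_mod_eq, Nat.succ_div]
  by_cases h : 2 ^ i ∣ k + 1 <;> simp [h]
  rcases Nat.mod_two_eq_zero_or_one (k / 2 ^ i) with h1 | h1 <;> simp [h1, Nat.add_mod]

theorem gray_succ (k i : ℕ) :
    gray (k + 1) i = (gray k i ^^ decide (i = padicValNat 2 (k + 1))) := by
  have e (j : ℕ) : 2 ^ j ∣ k + 1 ↔ j ≤ padicValNat 2 (k + 1) :=
    padicValNat_dvd_iff_le (p := 2) (by omega)
  simp only [gray, testBit_succ, e]
  have : decide (i = padicValNat 2 (k + 1)) =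
      (decide (i ≤ padicValNat 2 (k + 1)) ^^ decide (i + 1 ≤ padicValNat 2 (k + 1))) := by
    rcases lt_trichotomy i (padicValNat 2 (k + 1)) with h | h | h
    · have h1 : i ≠ padicValNat 2 (k + 1) := by omega
      have h2 : i ≤ padicValNat 2 (k + 1) := by omega
      have h3 : i + 1 ≤ padicValNat 2 (k + 1) := by omega
      simp [h1, h2, h3]
    · simp [h.symm]
    · have h1 : i ≠ padicValNat 2 (k + 1) := by omega
      have h2 : ¬ i ≤ padicValNat 2 (k + 1) := by omega
      have h3 : ¬ i + 1 ≤ padicValNat 2 (k + 1) := by omega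
      simp [h1, h2, h3]
  rw [this]
  cases k.testBit i <;> cases k.testBit (i + 1) <;>
    cases decide (i ≤ padicValNat 2 (k + 1)) <;> cases decide (i + 1 ≤ padicValNat 2 (k + 1)) <;> rfl

theorem gray_last (n i : ℕ) (hi : i ≤ n) : gray (2 ^ (n + 1) - 1) i = decide (i = n) := by
  simp only [gray, Nat.testBit_two_pow_sub_one]
  rcases hi.lt_or_eq with h | h
  · have h1 : i ≠ n := by omega
    have h2 : i < n + 1 := by omega
    simp [h, h1, h2]
  · simp [h]

theorem gray_inj (n k k' : ℕ) (hk : k < 2 ^ (n + 1)) (hk' : k' < 2 ^ (n + 1))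
    (h : ∀ i ≤ n, gray k i = gray k' i) : k = k' := by
  have key : ∀ t i, i + t = n + 1 → k.testBit i = k'.testBit i := by
    intro t
    induction t with
    | zero =>
      intro i hi
      obtain rfl : i = n + 1 := by omega
      rw [Nat.testBit_lt_two_pow hk, Nat.testBit_lt_two_pow hk']
    | succ t ih =>
      intro i hi
      have h1 := ih (i + 1) (by omega)
      have h2 := h i (by omega)
      simp only [gray, h1] at h2
      exact Bool.xor_left_inj.mp h2 
  apply Nat.eq_of_testBit_eq
  intro i
  rcases le_or_gt i (n + 1) with hi | hi
  · exact key (n + 1 - i) i (by omega)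
  · have : 2 ^ (n + 1) ≤ 2 ^ i := Nat.pow_le_pow_right (by omega) hi.le
    rw [Nat.testBit_lt_two_pow (by omega), Nat.testBit_lt_two_pow (by omega)]

theorem val_odd (l : ℕ) : padicValNat 2 (2 * l + 1) = 0 :=
  padicValNat.eq_zero_of_not_dvd (by omega)

theorem val_lt (n k : ℕ) (hk : k + 1 < 2 ^ (n + 1)) : padicValNat 2 (k + 1) < n + 1 := by
  by_contra h
  have := (padicValNat_dvd_iff_le (p := 2) (a := k + 1) (n := n + 1) (by omega)).2 (by omega)
  have := Nat.le_of_dvd (by omega) this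
  omega

theorem ofNat_swap {n : ℕ} (a i : Fin (n + 1)) (v : ℕ) (hv : v < n + 1) :
    (i = Equiv.swap a (Fin.last n) (Fin.ofNat (n + 1) v)) ↔
      ((Equiv.swap a (Fin.last n) i : Fin (n + 1)) : ℕ) = v := by
  rw [← Equiv.symm_apply_eq, Equiv.symm_swap, Fin.ext_iff, Fin.val_ofNat, Nat.mod_eq_of_lt hv]

theorem vertex_succ {n : ℕ} (e : Fin (n + 1) → Bool) (a : Fin (n + 1)) (k : ℕ)
    (hk : k + 1 < 2 ^ (n + 1)) (i : Fin (n + 1)) :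
    vertex e a (k + 1) i = (vertex e a k i ^^
      decide (i = Equiv.swap a (Fin.last n) (Fin.ofNat (n + 1) (padicValNat 2 (k + 1))))) := by
  simp only [vertex, gray_succ, ofNat_swap a i _ (val_lt n k hk), Bool.xor_assoc]

theorem vertex_zero {n : ℕ} (e : Fin (n + 1) → Bool) (a : Fin (n + 1)) : vertex e a 0 = e := by
  funext i; simp [vertex, gray_zero]

theorem vertex_last {n : ℕ} (e : Fin (n + 1) → Bool) (a i : Fin (n + 1)) :
    vertex e a (2 ^ (n + 1) - 1) i = (e i ^^ decide (i = a)) := by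
  rw [vertex, gray_last n _ (by omega)]
  congr 2
  have := ofNat_swap a i n (by omega)
  have h2 : Fin.ofNat (n + 1) n = Fin.last n := by ext; simp
  rw [h2, Equiv.swap_apply_right] at this
  exact propext this.symm

/-- the entry corner of the next subcube is one step away from the exit corner -/
theorem entry_succ {n : ℕ} (e : Fin (n + 1) → Bool) (a : Fin (n + 1)) (k : ℕ)
    (hk : k + 1 < 2 ^ (n + 1)) (i : Fin (n + 1)) :
    vertex e a (2 * ((k + 1 - 1) / 2)) i = ((vertex e a (2 * ((k - 1) / 2)) i ^^
      decide (i = axis a k)) ^^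
      decide (i = Equiv.swap a (Fin.last n) (Fin.ofNat (n + 1) (padicValNat 2 (k + 1))))) := by
  rcases Nat.even_or_odd' k with ⟨l, rfl | rfl⟩
  · rcases l with _ | l
    · simp [vertex_zero, axis]
    · have h1 : (2 * (l + 1) + 1 - 1) / 2 = l + 1 := by omega
      have h2 : (2 * (l + 1) - 1) / 2 = l := by omega
      have h3 : (2 * (l + 1) + 1) / 2 = l + 1 := by omega
      rw [axis, h1, h2, h3, val_odd, show 2 * (l + 1) = (2 * l + 1) + 1 by ring,
        vertex_succ _ _ _ (by omega), vertex_succ _ _ _ (by omega), val_odd]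
      cases vertex e a (2 * l) i <;>
        cases decide (i = Equiv.swap a (Fin.last n) (Fin.ofNat (n + 1) 0)) <;>
        cases decide (i = Equiv.swap a (Fin.last n)
          (Fin.ofNat (n + 1) (padicValNat 2 (2 * l + 1 + 1)))) <;> rfl
  · have h1 : (2 * l + 1 + 1 - 1) / 2 = l := by omega
    have h2 : (2 * l + 1 - 1) / 2 = l := by omega
    have h3 : (2 * l + 1 + 1) / 2 = l + 1 := by omega
    rw [axis, h1, h2, h3, show 2 * (l + 1) = 2 * l + 1 + 1 by ring]
    simp

theorem entry_side {n : ℕ} (e : Fin (n + 1) → Bool) (a : Fin (n + 1)) (k : ℕ)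
    (hk : k + 1 < 2 ^ (n + 1)) (i : Fin (n + 1))
    (hi : i = Equiv.swap a (Fin.last n) (Fin.ofNat (n + 1) (padicValNat 2 (k + 1)))) :
    vertex e a (2 * ((k + 1 - 1) / 2)) i = vertex e a k i := by
  rcases Nat.even_or_odd' k with ⟨l, rfl | rfl⟩
  · rw [show 2 * ((2 * l + 1 - 1) / 2) = 2 * l by omega]
  · rw [show 2 * ((2 * l + 1 + 1 - 1) / 2) = 2 * l by omega, vertex_succ _ _ (2 * l) (by omega)]
    rw [ofNat_swap _ _ _ (val_lt n _ hk)] at hi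
    have h1 : 1 ≤ padicValNat 2 (2 * l + 1 + 1) :=
      one_le_padicValNat_of_dvd (by omega) (by omega)
    have h2 := ofNat_swap a i (padicValNat 2 (2 * l + 1)) (val_lt n _ (by omega))
    rw [val_odd] at h2 ⊢
    have h3 : ¬ i = Equiv.swap a (Fin.last n) (Fin.ofNat (n + 1) 0) := by
      rw [h2]; omega
    rw [decide_eq_false h3, Bool.xor_false]

theorem exit_last {n : ℕ} (e : Fin (n + 1) → Bool) (a i : Fin (n + 1)) :
    (vertex e a (2 * ((2 ^ (n + 1) - 1 - 1) / 2)) i ^^ decide (i = axis a (2 ^ (n + 1) - 1))) =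
      (e i ^^ decide (i = a)) := by
  rw [← vertex_last e a i]
  obtain ⟨l, hl⟩ : ∃ l, 2 ^ (n + 1) = 2 * l + 2 := by
    refine ⟨2 ^ n - 1, ?_⟩
    have := Nat.two_pow_pos (n)
    rw [pow_succ]; omega
  have h1 : 2 ^ (n + 1) - 1 = 2 * l + 1 := by omega
  rw [axis, h1, vertex_succ _ _ _ (by omega), val_odd,
    show 2 * ((2 * l + 1 - 1) / 2) = 2 * l by omega,
    show 2 * ((2 * l + 1 + 1) / 2) = 2 ^ (n + 1) by omega, padicValNat.prime_pow]
  have : Fin.ofNat (n + 1) (n + 1) = Fin.ofNat (n + 1) 0 := by ext; simp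
  rw [this]

theorem cellFrom_first (n m : ℕ) (e : Fin (n + 1) → Bool) (a i : Fin (n + 1)) :
    cellFrom n m e a 0 i = (e i).toNat * (2 ^ m - 1) := by
  induction m generalizing e a with
  | zero => simp [cellFrom]
  | succ m ih =>
    simp only [cellFrom, Nat.zero_div, Nat.zero_mod, vertex_zero, ih, Nat.zero_sub, mul_zero]
    have := Nat.two_pow_pos (m)
    rw [pow_succ]
    cases e i <;> simp; omega

theorem split_top (n m : ℕ) : 2 ^ ((n + 1) * (m + 1)) = 2 ^ (n + 1) * 2 ^ ((n + 1) * m) := by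
  rw [← pow_add]; congr 1; ring

theorem cellFrom_last (n m : ℕ) (e : Fin (n + 1) → Bool) (a i : Fin (n + 1)) :
    cellFrom n m e a (2 ^ ((n + 1) * m) - 1) i = (e i ^^ decide (i = a)).toNat * (2 ^ m - 1) := by
  induction m generalizing e a with
  | zero => simp [cellFrom]
  | succ m ih =>
    have hN := Nat.two_pow_pos (n + 1)
    have hM := Nat.two_pow_pos ((n + 1) * m)
    have h0 : 2 ^ ((n + 1) * (m + 1)) - 1 =
        (2 ^ ((n + 1) * m) - 1) + 2 ^ ((n + 1) * m) * (2 ^ (n + 1) - 1) := by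
      rw [split_top]
      obtain ⟨u, hu⟩ := Nat.exists_eq_add_of_lt hN
      obtain ⟨v, hv⟩ := Nat.exists_eq_add_of_lt hM
      rw [hu, hv]
      simp
      ring_nf
      omega
    have hq : (2 ^ ((n + 1) * (m + 1)) - 1) / 2 ^ ((n + 1) * m) = 2 ^ (n + 1) - 1 := by
      rw [h0, Nat.add_mul_div_left _ _ hM, Nat.div_eq_of_lt (by omega), zero_add]
    have hr : (2 ^ ((n + 1) * (m + 1)) - 1) % 2 ^ ((n + 1) * m) = 2 ^ ((n + 1) * m) - 1 := by
      rw [h0, Nat.add_mul_mod_self_left, Nat.mod_eq_of_lt (by omega)]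
    simp only [cellFrom]
    rw [hq, hr, ih, exit_last, vertex_last]
    have := Nat.two_pow_pos (m)
    rw [pow_succ]
    cases (e i ^^ decide (i = a)) <;> simp; omega

theorem cellFrom_lt (n m : ℕ) (e : Fin (n + 1) → Bool) (a : Fin (n + 1)) (k : ℕ)
    (i : Fin (n + 1)) : cellFrom n m e a k i < 2 ^ m := by
  induction m generalizing e a k with
  | zero => simp [cellFrom]
  | succ m ih =>
    simp only [cellFrom]
    have := ih (vertex e a (2 * ((k / 2 ^ ((n + 1) * m) - 1) / 2)))
      (axis a (k / 2 ^ ((n + 1) * m))) (k % 2 ^ ((n + 1) * m))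
    rw [pow_succ]
    cases vertex e a (k / 2 ^ ((n + 1) * m)) i <;> simp <;> omega

theorem cellFrom_nested (n m : ℕ) (e : Fin (n + 1) → Bool) (a : Fin (n + 1)) (k : ℕ)
    (i : Fin (n + 1)) :
    cellFrom n (m + 1) e a k i / 2 = cellFrom n m e a (k / 2 ^ (n + 1)) i := by
  induction m generalizing e a k with
  | zero => cases h : vertex e a k i <;> simp [cellFrom, h]
  | succ m ih =>
    have hq : k / 2 ^ (n + 1) / 2 ^ ((n + 1) * m) = k / 2 ^ ((n + 1) * (m + 1)) := by
      rw [Nat.div_div_eq_div_mul, split_top]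
    have hr : k / 2 ^ (n + 1) % 2 ^ ((n + 1) * m) =
        k % 2 ^ ((n + 1) * (m + 1)) / 2 ^ (n + 1) := by
      rw [split_top, Nat.mod_mul_right_div_self]
    rw [cellFrom]
    conv_rhs => rw [cellFrom]
    simp only []
    rw [hq, hr, ← ih, pow_succ, ← mul_assoc]
    omega

theorem cellFrom_inj (n m : ℕ) (e : Fin (n + 1) → Bool) (a : Fin (n + 1)) :
    Set.InjOn (cellFrom n m e a) (Set.Iio (2 ^ ((n + 1) * m))) := by
  induction m generalizing e a with
  | zero =>
    intro k hk k' hk' _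
    simp at hk hk'
    omega
  | succ m ih =>
    intro k hk k' hk' h
    simp only [Set.mem_Iio] at hk hk'
    have hM := Nat.two_pow_pos ((n + 1) * m)
    have hq : k / 2 ^ ((n + 1) * m) = k' / 2 ^ ((n + 1) * m) := by
      apply gray_inj n
      · rw [Nat.div_lt_iff_lt_mul hM, ← split_top]; exact hk
      · rw [Nat.div_lt_iff_lt_mul hM, ← split_top]; exact hk'
      · intro i hi
        have h1 := congrFun h (Equiv.swap a (Fin.last n) ⟨i, by omega⟩)
        have h2 (k : ℕ) : cellFrom n (m + 1) e a k (Equiv.swap a (Fin.last n) ⟨i, by omega⟩) / 2 ^ m =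
            (vertex e a (k / 2 ^ ((n + 1) * m)) (Equiv.swap a (Fin.last n) ⟨i, by omega⟩)).toNat := by
          simp only [cellFrom]
          rw [add_comm, Nat.add_mul_div_right _ _ (by positivity),
            Nat.div_eq_of_lt (cellFrom_lt _ _ _ _ _ _), zero_add]
        have h3 := (h2 k).symm.trans ((congrArg (· / 2 ^ m) h1).trans (h2 k'))
        have h4 : vertex e a (k / 2 ^ ((n + 1) * m)) (Equiv.swap a (Fin.last n) ⟨i, by omega⟩) =
            vertex e a (k' / 2 ^ ((n + 1) * m)) (Equiv.swap a (Fin.last n) ⟨i, by omega⟩) := by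
          revert h3
          cases vertex e a (k / 2 ^ ((n + 1) * m)) (Equiv.swap a (Fin.last n) ⟨i, by omega⟩) <;>
            cases vertex e a (k' / 2 ^ ((n + 1) * m)) (Equiv.swap a (Fin.last n) ⟨i, by omega⟩) <;>
            simp
        simpa [vertex] using h4
    have hr : k % 2 ^ ((n + 1) * m) = k' % 2 ^ ((n + 1) * m) := by
      apply ih _ _ (Nat.mod_lt _ hM) (Nat.mod_lt _ hM)
      funext i
      have h1 := congrFun h i
      simp only [cellFrom] at h1
      rw [hq] at h1
      exact Nat.add_left_cancel h1
    rw [← Nat.div_add_mod k (2 ^ ((n + 1) * m)), hq, hr, Nat.div_add_mod]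

theorem cellFrom_adj (n m : ℕ) (e : Fin (n + 1) → Bool) (a : Fin (n + 1)) (k : ℕ)
    (hk : k + 1 < 2 ^ ((n + 1) * m)) : ∃ i,
    (cellFrom n m e a (k + 1) i = cellFrom n m e a k i + 1 ∨
      cellFrom n m e a k i = cellFrom n m e a (k + 1) i + 1) ∧
      ∀ j ≠ i, cellFrom n m e a (k + 1) j = cellFrom n m e a k j := by
  induction m generalizing e a k with
  | zero => simp at hk
  | succ m ih =>
    have hM := Nat.two_pow_pos ((n + 1) * m)
    have hm := Nat.two_pow_pos (m)
    by_cases hr : k % 2 ^ ((n + 1) * m) + 1 < 2 ^ ((n + 1) * m)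
    · have hq : (k + 1) / 2 ^ ((n + 1) * m) = k / 2 ^ ((n + 1) * m) := by
        rw [Nat.div_eq_iff hM]
        have := Nat.div_add_mod k (2 ^ ((n + 1) * m))
        rw [mul_comm] at this
        constructor <;> omega
      have hr' : (k + 1) % 2 ^ ((n + 1) * m) = k % 2 ^ ((n + 1) * m) + 1 := by
        have h := Nat.div_add_mod (k + 1) (2 ^ ((n + 1) * m))
        rw [hq] at h
        have := Nat.div_add_mod k (2 ^ ((n + 1) * m))
        omega
      obtain ⟨i, hi, hj⟩ := ih (vertex e a (2 * ((k / 2 ^ ((n + 1) * m) - 1) / 2)))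
        (axis a (k / 2 ^ ((n + 1) * m))) _ hr
      refine ⟨i, ?_, fun j hji => ?_⟩
      · simp only [cellFrom, hq, hr']; omega
      · simp only [cellFrom, hq, hr', hj j hji]
    · have hr0 : k % 2 ^ ((n + 1) * m) = 2 ^ ((n + 1) * m) - 1 := by
        have := Nat.mod_lt k hM; omega
      have hk1 : k + 1 = 2 ^ ((n + 1) * m) * (k / 2 ^ ((n + 1) * m) + 1) := by
        have := Nat.div_add_mod k (2 ^ ((n + 1) * m))
        rw [mul_add]; omega
      have hq : (k + 1) / 2 ^ ((n + 1) * m) = k / 2 ^ ((n + 1) * m) + 1 := by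
        rw [hk1, Nat.mul_div_cancel_left _ hM]
      have hr' : (k + 1) % 2 ^ ((n + 1) * m) = 0 := by
        rw [hk1, Nat.mul_mod_right]
      have hlt : k / 2 ^ ((n + 1) * m) + 1 < 2 ^ (n + 1) := by
        rw [← hq, Nat.div_lt_iff_lt_mul hM, ← split_top]; exact hk
      set q := k / 2 ^ ((n + 1) * m)
      refine ⟨Equiv.swap a (Fin.last n) (Fin.ofNat (n + 1) (padicValNat 2 (q + 1))), ?_,
        fun j hji => ?_⟩
      · have h1 := entry_succ e a q hlt _ |>.symm.trans (entry_side e a q hlt _ rfl)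
        have h2 := entry_side e a q hlt _ rfl
        have h3 := vertex_succ e a q hlt
          (Equiv.swap a (Fin.last n) (Fin.ofNat (n + 1) (padicValNat 2 (q + 1))))
        simp only [cellFrom]
        rw [hq, hr', hr0, cellFrom_first, cellFrom_last, h2, h3]
        simp only [decide_true, Bool.xor_true] at h1 ⊢
        rw [← h1]
        cases (vertex e a (2 * ((q - 1) / 2)) (Equiv.swap a (Fin.last n) (Fin.ofNat (n + 1) (padicValNat 2 (q + 1)))) ^^
          decide (Equiv.swap a (Fin.last n) (Fin.ofNat (n + 1) (padicValNat 2 (q + 1))) = axis a q)) <;> simp <;> omega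
      · have h1 := entry_succ e a q hlt j
        have h3 := vertex_succ e a q hlt j
        simp only [cellFrom]
        rw [hq, hr', hr0, cellFrom_first, cellFrom_last, h1, h3]
        rw [decide_eq_false hji, Bool.xor_false, Bool.xor_false]

/-- The Gray code construction is a Hilbert order, in every dimension. -/
theorem isHilbertOrder (n : ℕ) :
    IsHilbertOrder (n + 1) (fun m => cellFrom n m (fun _ => false) (Fin.last n)) where
  bijOn m := by
    have hmap : Set.MapsTo (cellFrom n m (fun _ => false) (Fin.last n))
        (Set.Iio (2 ^ ((n + 1) * m))) {c | ∀ j, c j < 2 ^ m} :=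
      fun k _ j => cellFrom_lt _ _ _ _ _ _
    refine ⟨hmap, cellFrom_inj _ _ _ _, ?_⟩
    have hT : ({c | ∀ j, c j < 2 ^ m} : Set (Fin (n + 1) → ℕ)) =
        ((Fintype.piFinset fun _ => Finset.range (2 ^ m) : Finset (Fin (n + 1) → ℕ)) : Set _) := by
      ext c; simp
    have hS : Set.Iio (2 ^ ((n + 1) * m)) = (Finset.range (2 ^ ((n + 1) * m)) : Set ℕ) := by
      ext c; simp
    have hinj := cellFrom_inj n m (fun _ => false) (Fin.last n)
    rw [hT, hS] at hmap ⊢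
    rw [hS] at hinj
    refine Finset.surjOn_of_injOn_of_card_le _ hmap hinj ?_
    simp [← pow_mul, mul_comm]
  nested m k _ j := cellFrom_nested _ _ _ _ _ _
  adjacent m k hk := cellFrom_adj _ _ _ _ _ hk
  start m j := by simp [cellFrom_first]

end GrayHilbert

theorem exists_isHilbertOrder (d : ℕ) (hd : 1 ≤ d) :
    ∃ cell : ℕ → ℕ → Fin d → ℕ, IsHilbertOrder d cell := by
  obtain ⟨n, rfl⟩ := Nat.exists_eq_add_of_le' hd
  exact ⟨_, GrayHilbert.isHilbertOrder n⟩

/-! ### The scrambled van der Corput sequence -/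

/-- The digits of `i` in base `b`, the least significant one first. -/
def baseDigits (b : ℕ) [NeZero b] (i j : ℕ) : Fin b := Fin.ofNat b (i / b ^ j)

/-- A family of independent random permutations of `{0, …, b - 1}`, indexed by the finite words
over this alphabet, each of them uniformly distributed over the `b!` permutations. -/
structure IsUniformScrambling {S : Type*} [MeasurableSpace S] (P : Measure S) {b : ℕ}
    (π : List (Fin b) → S → Equiv.Perm (Fin b)) : Prop where
  measurableSet : ∀ w τ, MeasurableSet {s | π w s = τ}
  uniform : ∀ w τ, P {s | π w s = τ} = (b.factorial : ENNReal)⁻¹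
  indep : iIndepFun (m := fun _ => (⊤ : MeasurableSpace (Equiv.Perm (Fin b)))) π P

/-- The point with index `i` (counted from `0`) of the nested uniformly scrambled van der Corput
sequence in base `b`: if `0.a₀a₁a₂…` is the van der Corput point with index `i`, then digit number
`j` of the scrambled point is the image of `a_j` under the permutation of the word `a₀…a_{j-1}`. -/
noncomputable def scrambledVdc {S : Type*} {b : ℕ} [NeZero b]
    (π : List (Fin b) → S → Equiv.Perm (Fin b)) (i : ℕ) (s : S) : ℝ :=
  Real.ofDigits fun j => π ((List.range j).map (baseDigits b i)) s (baseDigits b i j)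

/-- The estimate `(1/n) * ∑ f (H (xᵢ))` of the integral of `f`, where the sum is over the first
`n` points `xᵢ` of the scrambled van der Corput sequence. -/
noncomputable def estimate {S : Type*} {b d : ℕ} [NeZero b] (cell : ℕ → ℕ → Fin d → ℕ)
    (π : List (Fin b) → S → Equiv.Perm (Fin b)) (f : EuclideanSpace ℝ (Fin d) → ℝ) (n : ℕ)
    (s : S) : ℝ :=
  (1 / (n : ℝ)) * ∑ i ∈ Finset.range n, f (hilbertCurve d cell (scrambledVdc π i s))

/-! ### Minkowski content -/

/-- The closed `ε`-neighbourhood `{x + y | x ∈ A, ‖y‖ ≤ ε}`. -/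
def neighbourhood {d : ℕ} (A : Set (EuclideanSpace ℝ (Fin d))) (ε : ℝ) :
    Set (EuclideanSpace ℝ (Fin d)) :=
  {z | ∃ x ∈ A, ∃ y : EuclideanSpace ℝ (Fin d), ‖y‖ ≤ ε ∧ z = x + y}

/-- The set `A` admits a `(d - 1)`-dimensional Minkowski content: the limit of
`volume (A_ε) / (2 ε)` as `ε ↓ 0` exists and is finite. -/
def HasMinkowskiContent {d : ℕ} (A : Set (EuclideanSpace ℝ (Fin d))) : Prop :=
  ∃ M : NNReal, Tendsto (fun ε : ℝ => volume (neighbourhood A ε) / ENNReal.ofReal (2 * ε))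
    (𝓝[>] 0) (𝓝 (M : ENNReal))

end HSFC

namespace HSFC

/-! ### Uniform points and strata of equal length -/

section

/-! Fix n = b^m. Scrambling puts exactly one of the first n points into each stratum [k/n, (k+1)/n].
The stratum of a point is decided by permutations of words shorter than m, its position inside the
stratum by permutations of words of length at least m, and distinct points use distinct words there.
So the positions, listed by stratum, are independent and uniform
(`IsUniformScrambling.measurePreserving_offset`), and the estimate has the law of a stratified mean
of f ∘ H. The Minkowski content makes ∂Ω a null set, and H carries Lebesgue measure to Lebesgue
measure (`map_hilbertCurve`), so Ω may be replaced by its interior U and f ∘ H by a bounded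
measurable function F.

Variance. By independence n² Var is the sum of the variances of F over the strata. A stratum
contains whole dyadic time intervals of some level p with 2n ≤ 2^(dp) < 2^(d+1) n, and these fill at
least a third of it (`le_integral_stratum`). During such an interval H sweeps out a cube of side
2^(-p). Well inside U, g is nearly affine there, with some derivative L, and an affine function has
mean square distance at least 4^(-p) ‖L‖² / 12 from every constant (`le_integral_cube_sub_sq`).
Summing over the strata that meet a compact K ⊂ U carrying almost all of σ² gives σ²/16 ≤ 3 · 4^p ·
n · Var, and 4^p ≤ 4 · 2^(2/d) n^(2/d) yields the bound (`eventually_le_variance_stratifiedMean`).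

Limit law. The bound makes n² Var at least a multiple of n^(1-2/d), which diverges for d > 2. The n
independent summands are bounded, so after standardisation they are uniformly small, and
characteristic functions give the central limit theorem (`tendsto_charFun_stratifiedMean`). -/

/-- The uniform distribution on `[0,1]`. -/
noncomputable def unif : Measure ℝ := volume.restrict (Set.Icc 0 1)

instance : IsProbabilityMeasure unif := ⟨by simp [unif]⟩

theorem integral_unif {E : Type*} [NormedAddCommGroup E] [NormedSpace ℝ E] (f : ℝ → E) :
    ∫ x, f x ∂unif = ∫ x in (0 : ℝ)..1, f x := by
  rw [unif, integral_Icc_eq_integral_Ioc, intervalIntegral.integral_of_le zero_le_one]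

theorem intervalIntegrable_of_unif {E : Type*} [NormedAddCommGroup E] {f : ℝ → E}
    (hf : Integrable f unif) {a b : ℝ} (ha : 0 ≤ a) (hab : a ≤ b) (hb : b ≤ 1) :
    IntervalIntegrable f volume a b := by
  rw [intervalIntegrable_iff_integrableOn_Icc_of_le hab]
  exact IntegrableOn.mono_set (show IntegrableOn f (Set.Icc 0 1) volume from hf)
    (Set.Icc_subset_Icc ha hb)

theorem integral_unif_stratum {E : Type*} [NormedAddCommGroup E] [NormedSpace ℝ E] (f : ℝ → E)
    {n : ℕ} (hn : 0 < n) (k : ℕ) :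
    ∫ v, f ((k + v) / n) ∂unif = (n : ℝ) • ∫ x in (k / n : ℝ)..((k + 1 : ℕ) / n), f x := by
  have hn' : (n : ℝ) ≠ 0 := by positivity
  rw [integral_unif]
  have := intervalIntegral.integral_comp_mul_add (a := 0) (b := 1) f (inv_ne_zero hn') (k / n : ℝ)
  rw [inv_inv, mul_zero, zero_add] at this
  rw [show (((k + 1 : ℕ) : ℝ) / n) = (n : ℝ)⁻¹ * 1 + k / n by push_cast; field_simp; ring, ← this]
  congr 1
  ext v
  congr 1
  field_simp
  ring

theorem stratum_le {n : ℕ} {k : ℕ} (hk : k < n) : (((k + 1 : ℕ) : ℝ) / n) ≤ 1 := by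
  have : 0 < (n : ℝ) := by exact_mod_cast (by omega : 0 < n)
  rw [div_le_one this]
  exact_mod_cast hk

theorem integral_unif_eq_sum_strata {E : Type*} [NormedAddCommGroup E] [NormedSpace ℝ E]
    {f : ℝ → E} (hf : Integrable f unif) {n : ℕ} (hn : 0 < n) :
    ∫ x, f x ∂unif = ∑ k ∈ Finset.range n, ∫ x in (k / n : ℝ)..((k + 1 : ℕ) / n), f x := by
  have hn' : (n : ℝ) ≠ 0 := by positivity
  rw [intervalIntegral.sum_integral_adjacent_intervals (a := fun k : ℕ => (k / n : ℝ)),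
    integral_unif]
  · simp [hn']
  · intro k hk
    refine intervalIntegrable_of_unif hf (by positivity) ?_ (stratum_le hk)
    gcongr
    simp

/-- A uniform point splits into a uniform choice of one of `n` intervals of equal length and a
uniform point in this interval. -/
theorem integral_unif_split {E : Type*} [NormedAddCommGroup E] [NormedSpace ℝ E]
    {f : ℝ → E} (hf : Integrable f unif) {n : ℕ} (hn : 0 < n) :
    ∫ x, f x ∂unif = (n : ℝ)⁻¹ • ∑ k ∈ Finset.range n, ∫ v, f ((k + v) / n) ∂unif := by
  have hn' : (n : ℝ) ≠ 0 := by positivity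
  simp_rw [integral_unif_stratum f hn]
  rw [← Finset.smul_sum, smul_smul, inv_mul_cancel₀ hn', one_smul,
    integral_unif_eq_sum_strata hf hn]

theorem ae_unif_stratum {p : ℝ → Prop} (hp : ∀ᵐ x ∂unif, p x) {n : ℕ} {k : ℕ} (hk : k < n) :
    ∀ᵐ v ∂unif, p ((k + v) / n) := by
  have hn' : 0 < (n : ℝ) := by exact_mod_cast (by omega : 0 < n)
  have hk' := stratum_le hk
  rw [unif, ae_restrict_iff' measurableSet_Icc] at hp ⊢
  have h1 := (Measure.quasiMeasurePreserving_smul (volume : Measure ℝ) (inv_ne_zero hn'.ne')).ae hp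
  have h2 := (measurePreserving_add_left volume (k : ℝ)).quasiMeasurePreserving.ae h1
  filter_upwards [h2] with v hv hv1
  have e : (n : ℝ)⁻¹ • ((k : ℝ) + v) = (k + v) / n := by rw [smul_eq_mul]; field_simp
  rw [e] at hv
  refine hv ⟨by have := hv1.1; positivity, le_trans ?_ hk'⟩
  push_cast
  gcongr
  exact hv1.2

/-! ### Random digits -/

theorem tendsto_charFun_zero (μ : Measure ℝ) [IsProbabilityMeasure μ] (u : ℕ → ℝ)
    (hu : Tendsto u atTop (𝓝 0)) : Tendsto (fun n => charFun μ (u n)) atTop (𝓝 1) := by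
  have h := (continuous_charFun (μ := μ)).tendsto 0
  simp only [charFun_zero, probReal_univ] at h
  exact (by simpa using h : Tendsto (charFun μ) (𝓝 0) (𝓝 1)).comp hu

/-- A uniform point is (a + v) / b with a uniform leading digit a and an independent uniform v. This
is the functional equation that `map_ofDigits` iterates. -/
theorem charFun_unif_split {b : ℕ} (hb : 0 < b) (t : ℝ) :
    charFun unif t = ((b : ℝ)⁻¹ • ∑ a ∈ Finset.range b,
      Complex.exp ((t / b : ℝ) * a * Complex.I)) * charFun unif (t / b) := by
  have hb' : (b : ℂ) ≠ 0 := by exact_mod_cast hb.ne'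
  simp only [charFun_apply_real]
  rw [integral_unif_split (n := b) _ hb]
  · rw [smul_mul_assoc, Finset.sum_mul]
    congr 1
    refine Finset.sum_congr rfl fun a _ => ?_
    rw [← integral_const_mul]
    congr 1
    ext v
    rw [← Complex.exp_add]
    congr 1
    push_cast
    field_simp
  · refine Integrable.of_bound (C := 1) (by fun_prop) (ae_of_all _ fun x => ?_)
    rw [← Complex.ofReal_mul, Complex.norm_exp_ofReal_mul_I]

variable {S : Type*} [MeasurableSpace S] {P : Measure S}

theorem measurable_ofDigits {b : ℕ} {D : ℕ → S → Fin b} (hD : ∀ j, Measurable (D j)) :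
    Measurable fun s => Real.ofDigits fun j => D j s := by
  have : Measurable (Real.ofDigits (b := b)) := Real.continuous_ofDigits.measurable
  exact this.comp (measurable_pi_lambda _ hD)

/-- A number with independent, uniformly distributed digits is uniformly distributed. -/
theorem map_ofDigits {b : ℕ} (hb : 2 ≤ b) [IsProbabilityMeasure P] {D : ℕ → S → Fin b}
    (hD : ∀ j, Measurable (D j)) (hunif : ∀ j a, P {s | D j s = a} = (b : ENNReal)⁻¹)
    (hind : iIndepFun D P) : P.map (fun s => Real.ofDigits fun j => D j s) = unif := by
  have hb0 : 0 < b := by omega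
  have hmeas := measurable_ofDigits hD
  have : IsProbabilityMeasure (P.map (fun s => Real.ofDigits fun j => D j s)) :=
    Measure.isProbabilityMeasure_map hmeas.aemeasurable
  set A : ℝ → ℂ := fun t => (b : ℝ)⁻¹ • ∑ a ∈ Finset.range b, Complex.exp (t * a * Complex.I)
    with hA
  refine Measure.ext_of_charFun (funext fun t => ?_)
  -- The last factor tends to 1, so the characteristic function of `unif` is the limit of these
  -- products. The same products are the characteristic functions of the partial sums of the random
  -- digit expansion.
  have hpart (n : ℕ) : charFun unif t =
      (∏ j ∈ Finset.range n, A (t / b ^ (j + 1))) * charFun unif (t / b ^ n) := by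
    induction n with
    | zero => simp
    | succ n ih =>
      rw [ih, charFun_unif_split hb0 (t / b ^ n), Finset.prod_range_succ, mul_assoc, div_div,
        ← pow_succ]
  let X : ℕ → S → ℝ := fun j s => Real.ofDigitsTerm (fun j => D j s) j
  have hXm (j : ℕ) : Measurable (X j) := by
    have : Measurable fun a : Fin b => (a : ℝ) * ((b : ℝ) ^ (j + 1))⁻¹ := measurable_of_finite _
    exact this.comp (hD j)
  have hXi : iIndepFun X P :=
    hind.comp (fun j a => (a : ℝ) * ((b : ℝ) ^ (j + 1))⁻¹) fun j => measurable_of_finite _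
  have hterm (j : ℕ) : charFun (P.map (X j)) t = A (t / b ^ (j + 1)) := by
    rw [charFun_apply_real, integral_map (hXm j).aemeasurable (by fun_prop)]
    have h1 : ∫ s, Complex.exp (t * (X j s : ℝ) * Complex.I) ∂P =
        ∫ a, Complex.exp (t * ((a : ℝ) * ((b : ℝ) ^ (j + 1))⁻¹ : ℝ) * Complex.I)
          ∂(P.map (D j)) := by
      rw [integral_map (hD j).aemeasurable (measurable_of_finite _).aestronglyMeasurable]
      rfl
    rw [h1, integral_fintype (Integrable.of_finite), hA]
    simp only
    rw [Finset.sum_range, Finset.smul_sum]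
    refine Finset.sum_congr rfl fun a _ => ?_
    congr 1
    · rw [Measure.real, Measure.map_apply (hD j) (measurableSet_singleton a)]
      have := hunif j a
      rw [show D j ⁻¹' {a} = {s | D j s = a} from rfl, this]
      simp
    · congr 1
      push_cast
      ring
  have hlim1 : Tendsto (fun n => charFun (P.map (∑ j ∈ Finset.range n, X j)) t) atTop
      (𝓝 (charFun (P.map (fun s => Real.ofDigits fun j => D j s)) t)) := by
    have hm (n : ℕ) : Measurable (∑ j ∈ Finset.range n, X j) := by
      rw [Finset.sum_fn]
      exact Finset.measurable_sum _ fun j _ => hXm j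
    simp only [charFun_apply_real]
    rw [integral_map hmeas.aemeasurable (by fun_prop)]
    simp_rw [integral_map (hm _).aemeasurable
      (show AEStronglyMeasurable (fun x : ℝ => Complex.exp (t * x * Complex.I)) _ by fun_prop)]
    refine tendsto_integral_of_dominated_convergence (fun _ => 1) (fun n => ?_)
      (integrable_const _) (fun n => ae_of_all _ fun s => ?_) (ae_of_all _ fun s => ?_)
    · have : Measurable fun s => Complex.exp (t * ((∑ j ∈ Finset.range n, X j) s : ℝ) * Complex.I) :=
        (show Measurable (fun x : ℝ => Complex.exp (t * x * Complex.I)) by fun_prop).comp (hm n)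
      exact this.aestronglyMeasurable
    · rw [← Complex.ofReal_mul, Complex.norm_exp_ofReal_mul_I]
    · have h1 : Tendsto (fun n => (∑ j ∈ Finset.range n, X j) s) atTop
          (𝓝 (Real.ofDigits fun j => D j s)) := by
        simp only [Finset.sum_apply]
        exact (Real.summable_ofDigitsTerm (digits := fun j => D j s)).hasSum.tendsto_sum_nat
      exact ((show Continuous (fun x : ℝ => Complex.exp (t * x * Complex.I)) by
        fun_prop).tendsto _).comp h1
  have hprod (n : ℕ) : charFun (P.map (∑ j ∈ Finset.range n, X j)) t =
      ∏ j ∈ Finset.range n, A (t / b ^ (j + 1)) := by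
    rw [iIndepFun.charFun_map_finsetSum_eq_prod (fun j _ => (hXm j).aemeasurable)
      (hXi.precomp (g := fun j : Finset.range n => (j : ℕ)) Subtype.val_injective), Finset.prod_apply]
    exact Finset.prod_congr rfl fun j _ => hterm j
  have hu : Tendsto (fun n : ℕ => t / (b : ℝ) ^ n) atTop (𝓝 0) :=
    tendsto_const_nhds.div_atTop (tendsto_pow_atTop_atTop_of_one_lt (by exact_mod_cast hb))
  have h2 := hlim1.mul (tendsto_charFun_zero unif _ hu)
  simp_rw [hprod, ← hpart, mul_one] at h2
  exact tendsto_nhds_unique h2 tendsto_const_nhds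

/-- Variables grouped by the first coordinate of the index of an independent family are
independent. -/
theorem iIndepFun_curry {ι κ X : Type*} [MeasurableSpace X] [IsProbabilityMeasure P]
    {Y : ι × κ → S → X} (hY : ∀ p, Measurable (Y p)) (h : iIndepFun Y P) :
    iIndepFun (fun i s j => Y (i, j) s) P := by
  have (p : ι × κ) : IsProbabilityMeasure (P.map (Y p)) :=
    Measure.isProbabilityMeasure_map (hY p).aemeasurable
  have hm (i : ι) : Measurable fun s j => Y (i, j) s := measurable_pi_lambda _ fun j => hY _
  have h1 := (iIndepFun_iff_map_fun_eq_infinitePi_map hY).1 h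
  rw [iIndepFun_iff_map_fun_eq_infinitePi_map hm]
  have h2 := Measure.infinitePi_map_curry (fun i j => P.map (Y (i, j)))
  have h3 (i : ι) : P.map (fun s j => Y (i, j) s) = Measure.infinitePi fun j => P.map (Y (i, j)) :=
    (iIndepFun_iff_map_fun_eq_infinitePi_map (fun j => hY (i, j))).1
      (h.precomp (g := fun j => (i, j)) (fun _ _ e => (Prod.ext_iff.1 e).2))
  simp_rw [h3]
  rw [← h2, ← h1, Measure.map_map (by fun_prop) (measurable_pi_lambda _ hY)]
  rfl

end

/-- Relabelling an independent, identically distributed family by an independent random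
permutation does not change its law. -/
theorem map_comp_randomPerm {S : Type*} [MeasurableSpace S] {P : Measure S}
    {n : ℕ} {E : Type*} [MeasurableSpace E] (ν : Measure E) [SigmaFinite ν]
    {V : S → Fin n → E} (hV : Measurable V) (hlaw : P.map V = Measure.pi fun _ => ν)
    {τ : S → Equiv.Perm (Fin n)} (hτ : ∀ σ, MeasurableSet {s | τ s = σ})
    (hind : ∀ σ B, MeasurableSet B → P ({s | τ s = σ} ∩ V ⁻¹' B) = P {s | τ s = σ} * P (V ⁻¹' B))
    [IsProbabilityMeasure P] :
    MeasurePreserving (fun s k => V s ((τ s).symm k)) P (Measure.pi fun _ => ν) := by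
  have hperm (σ : Equiv.Perm (Fin n)) : MeasurePreserving (fun (v : Fin n → E) k => v (σ.symm k))
      (Measure.pi fun _ => ν) (Measure.pi fun _ => ν) := by
    have := measurePreserving_piCongrLeft (fun _ : Fin n => ν) σ
    convert this using 1
    ext v k
    have := MeasurableEquiv.piCongrLeft_apply_apply (β := fun _ : Fin n => E) σ v (σ.symm k)
    simpa using this.symm
  -- Split by the value σ of the random permutation: on each piece the relabelling is a fixed
  -- permutation of coordinates, which preserves the product measure, and V is independent of the
  -- piece.
  have hcover (B : Set (Fin n → E)) : (fun s k => V s ((τ s).symm k)) ⁻¹' B =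
      ⋃ σ, ({s | τ s = σ} ∩ V ⁻¹' ((fun v k => v (σ.symm k)) ⁻¹' B)) := by
    ext s
    simp
  have hmeas : Measurable fun s k => V s ((τ s).symm k) := by
    intro B hB
    rw [hcover]
    exact MeasurableSet.iUnion fun σ => (hτ σ).inter (hV ((hperm σ).measurable hB))
  refine ⟨hmeas, Measure.ext fun B hB => ?_⟩
  rw [Measure.map_apply hmeas hB, hcover, measure_iUnion]
  · have h1 (σ : Equiv.Perm (Fin n)) :
        P ({s | τ s = σ} ∩ V ⁻¹' ((fun v k => v (σ.symm k)) ⁻¹' B)) =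
          P {s | τ s = σ} * (Measure.pi fun _ => ν) B := by
      have hB' := (hperm σ).measurable hB
      rw [hind _ _ hB', ← Measure.map_apply hV hB', hlaw,
        (hperm σ).measure_preimage hB.nullMeasurableSet]
    simp_rw [h1]
    rw [ENNReal.tsum_mul_right]
    have h2 : ∑' σ, P {s | τ s = σ} = 1 := by
      rw [← measure_iUnion (fun σ σ' h => ?_) hτ]
      · rw [← measure_univ (μ := P)]
        congr 1
        ext s
        simp
      · exact Set.disjoint_left.2 fun s hs hs' => h (hs.symm.trans hs')
    rw [h2, one_mul]
  · exact fun σ σ' h => Set.disjoint_left.2 fun s hs hs' => h (hs.1.symm.trans hs'.1)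
  · exact fun σ => (hτ σ).inter (hV ((hperm σ).measurable hB))

theorem IsUniformScrambling.measurable {S : Type*} [MeasurableSpace S] {P : Measure S} {b : ℕ}
    {π : List (Fin b) → S → Equiv.Perm (Fin b)}
    (hπ : IsUniformScrambling P π) (w : List (Fin b)) :
    Measurable[_, (⊤ : MeasurableSpace (Equiv.Perm (Fin b)))] (π w) := by
  let : MeasurableSpace (Equiv.Perm (Fin b)) := ⊤
  exact measurable_to_countable' fun τ => hπ.measurableSet w τ

/-! ### The scrambled points as a stratified sample -/

section Scrambling

variable {S : Type*} {b : ℕ} [NeZero b] (π : List (Fin b) → S → Equiv.Perm (Fin b))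

/-- Digit `j` of the scrambled point with index `i`. -/
def scrambledDigit (i j : ℕ) (s : S) : Fin b :=
  π ((List.range j).map (baseDigits b i)) s (baseDigits b i j)

/-- The index among the intervals `[k / b ^ m, (k + 1) / b ^ m)` of the one that contains the
scrambled point with index `i`. -/
def stratum (i : ℕ) (s : S) : ℕ → ℕ
  | 0 => 0
  | m + 1 => stratum i s m * b + scrambledDigit π i m s

/-- The position of the scrambled point with index `i` in its interval of length `b ^ (-m)`. -/
noncomputable def offset (m i : ℕ) (s : S) : ℝ :=
  Real.ofDigits fun j => scrambledDigit π i (m + j) s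

/-- The digit expansion is cut after m digits: the head is an integer over b^m, and the tail is
rescaled by b^(-m). -/
theorem scrambledVdc_eq (m i : ℕ) (s : S) :
    scrambledVdc π i s = (stratum π i s m + offset π m i s) / (b ^ m : ℕ) := by
  have hb : (b : ℝ) ≠ 0 := by exact_mod_cast NeZero.ne b
  have h1 (m : ℕ) : ∑ j ∈ Finset.range m, Real.ofDigitsTerm (fun j => scrambledDigit π i j s) j =
      stratum π i s m / b ^ m := by
    induction m with
    | zero => simp [stratum]
    | succ m ih =>
      rw [Finset.sum_range_succ, ih, stratum, Real.ofDigitsTerm]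
      push_cast
      field_simp
      ring
  have h2 := Real.ofDigits_eq_sum_add_ofDigits (fun j => scrambledDigit π i j s) m
  rw [h1] at h2
  have h3 : offset π m i s = Real.ofDigits fun j => scrambledDigit π i (j + m) s := by
    simp_rw [offset, add_comm m]
  rw [h3, show scrambledVdc π i s = Real.ofDigits fun j => scrambledDigit π i j s from rfl, h2]
  push_cast
  field_simp

theorem stratum_lt (i : ℕ) (s : S) (m : ℕ) : stratum π i s m < b ^ m := by
  induction m with
  | zero => simp [stratum]
  | succ m ih =>
    have := (scrambledDigit π i m s).isLt
    rw [stratum, pow_succ]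
    calc _ < stratum π i s m * b + b := by omega
      _ = (stratum π i s m + 1) * b := by ring
      _ ≤ _ := Nat.mul_le_mul_right _ ih

theorem mod_eq_of_baseDigits_eq {i i' m : ℕ} (h : ∀ j < m, baseDigits b i j = baseDigits b i' j) :
    i % b ^ m = i' % b ^ m := by
  induction m with
  | zero => simp [Nat.mod_one]
  | succ m ih =>
    have h1 := h m (by omega)
    simp only [baseDigits, Fin.ext_iff, Fin.val_ofNat] at h1
    rw [pow_succ, Nat.mod_mul, Nat.mod_mul, ih fun j hj => h j (by omega), h1]

/-- Unscrambling proceeds digit by digit: once the earlier digits agree, the next ones are scrambled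
by the same permutation, which is injective. -/
theorem baseDigits_eq_of_stratum_eq {i i' : ℕ} {s : S} {m : ℕ}
    (h : stratum π i s m = stratum π i' s m) : ∀ j < m, baseDigits b i j = baseDigits b i' j := by
  induction m with
  | zero => simp
  | succ m ih =>
    have hb : 0 < b := Nat.pos_of_ne_zero (NeZero.ne b)
    rw [stratum, stratum] at h
    have hd (i : ℕ) : (stratum π i s m * b + scrambledDigit π i m s) / b = stratum π i s m := by
      rw [add_comm, Nat.add_mul_div_right _ _ hb, Nat.div_eq_of_lt (Fin.isLt _), zero_add]
    have h1 : stratum π i s m = stratum π i' s m := by rw [← hd i, h, hd]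
    have h2 : scrambledDigit π i m s = scrambledDigit π i' m s := by
      rw [h1] at h
      exact Fin.ext (Nat.add_left_cancel h)
    have h3 := ih h1
    intro j hj
    rcases Nat.lt_succ_iff_lt_or_eq.1 hj with hj | rfl
    · exact h3 j hj
    · have h4 : (List.range j).map (baseDigits b i) = (List.range j).map (baseDigits b i') :=
        List.map_congr_left fun l hl => h3 l (List.mem_range.1 hl)
      rw [scrambledDigit, scrambledDigit, h4] at h2
      exact (π _ s).injective h2

theorem stratum_injOn (s : S) (m : ℕ) :
    Function.Injective fun i : Fin (b ^ m) => (⟨stratum π i s m, stratum_lt π i s m⟩ : Fin (b ^ m)) := by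
  intro i i' h
  have h1 := mod_eq_of_baseDigits_eq (baseDigits_eq_of_stratum_eq π (Fin.ext_iff.1 h))
  rw [Nat.mod_eq_of_lt i.isLt, Nat.mod_eq_of_lt i'.isLt] at h1
  exact Fin.ext h1

/-- The random permutation that tells which point lies in which interval of length `b ^ (-m)`. -/
noncomputable def stratumPerm (m : ℕ) (s : S) : Equiv.Perm (Fin (b ^ m)) :=
  Equiv.ofBijective _ (Finite.injective_iff_bijective.1 (stratum_injOn π s m))

theorem val_stratumPerm (m : ℕ) (s : S) (i : Fin (b ^ m)) :
    (stratumPerm π m s i : ℕ) = stratum π i s m := rfl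

/-- The stratified estimate built from one point in each interval of length `1 / n`. -/
noncomputable def stratifiedMean (F : ℝ → ℝ) (n : ℕ) (v : Fin n → ℝ) : ℝ :=
  (1 / (n : ℝ)) * ∑ k : Fin n, F ((k + v k) / n)

/-- The identity holds pointwise in s, not merely in law: the points are reordered by the strata
that they occupy, whence the inverse permutation. -/
theorem estimate_eq_stratifiedMean {d : ℕ} (cell : ℕ → ℕ → Fin d → ℕ)
    (f : EuclideanSpace ℝ (Fin d) → ℝ) (m : ℕ) (s : S) :
    estimate cell π f (b ^ m) s = stratifiedMean (fun x => f (hilbertCurve d cell x)) (b ^ m)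
      fun k => offset π m ((stratumPerm π m s).symm k) s := by
  rw [estimate, stratifiedMean, Finset.sum_range]
  congr 1
  refine Fintype.sum_equiv (stratumPerm π m s) _ _ fun i => ?_
  rw [scrambledVdc_eq π m, Equiv.symm_apply_apply, val_stratumPerm]

variable [MeasurableSpace S] {P : Measure S}

theorem IsUniformScrambling.measurable_scrambledDigit {π : List (Fin b) → S → Equiv.Perm (Fin b)}
    (hπ : IsUniformScrambling P π) (i j : ℕ) : Measurable (scrambledDigit π i j) := by
  let : MeasurableSpace (Equiv.Perm (Fin b)) := ⊤
  exact (measurable_from_top (f := fun τ : Equiv.Perm (Fin b) => τ (baseDigits b i j))).comp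
    (hπ.measurable _)

/-- Composition with the transposition of a and a' exchanges the permutations with τ x = a and those
with τ x = a', so the b fibres of τ ↦ τ x have equal size. -/
theorem card_perm_apply_eq (b : ℕ) (x a : Fin b) :
    Fintype.card {τ : Equiv.Perm (Fin b) // τ x = a} * b = b.factorial := by
  classical
  have h (a' : Fin b) : Fintype.card {τ : Equiv.Perm (Fin b) // τ x = a'} =
      Fintype.card {τ : Equiv.Perm (Fin b) // τ x = a} := by
    refine Fintype.card_congr (Equiv.subtypeEquiv (Equiv.mulLeft (Equiv.swap a' a)) fun τ => ?_)
    rw [Equiv.coe_mulLeft, Equiv.Perm.mul_apply]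
    constructor
    · rintro rfl; simp
    · intro h
      rw [Equiv.swap_apply_eq_iff] at h
      simpa using h
  have h2 : Fintype.card (Equiv.Perm (Fin b)) =
      ∑ a' : Fin b, Fintype.card {τ : Equiv.Perm (Fin b) // τ x = a'} := by
    rw [← Fintype.card_sigma]
    exact Fintype.card_congr (Equiv.sigmaFiberEquiv fun τ : Equiv.Perm (Fin b) => τ x).symm
  rw [Fintype.card_perm, Fintype.card_fin] at h2
  simp [h2, h, mul_comm]

theorem IsUniformScrambling.scrambledDigit_uniform {π : List (Fin b) → S → Equiv.Perm (Fin b)}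
    (hπ : IsUniformScrambling P π) (i j : ℕ) (a : Fin b) :
    P {s | scrambledDigit π i j s = a} = (b : ENNReal)⁻¹ := by
  classical
  set w := (List.range j).map (baseDigits b i)
  set x := baseDigits b i j
  have h1 : {s | scrambledDigit π i j s = a} =
      ⋃ τ : {τ : Equiv.Perm (Fin b) // τ x = a}, {s | π w s = τ} := by
    ext s
    simp only [Set.mem_ofPred_eq, Set.mem_iUnion, Subtype.exists, exists_prop]
    exact ⟨fun h => ⟨_, h, rfl⟩, by rintro ⟨τ, h, h'⟩; rw [← h, ← h']; rfl⟩
  rw [h1, measure_iUnion]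
  · simp only [hπ.uniform, tsum_fintype, Finset.sum_const, Finset.card_univ, nsmul_eq_mul]
    have h2 := card_perm_apply_eq b x a
    rw [← h2]
    have h3 : Fintype.card {τ : Equiv.Perm (Fin b) // τ x = a} ≠ 0 := by
      intro h; rw [h, zero_mul] at h2; exact (Nat.factorial_pos b).ne h2
    push_cast
    rw [ENNReal.mul_inv (by simp) (by simp), ← mul_assoc,
      ENNReal.mul_inv_cancel (by exact_mod_cast h3) (by simp), one_mul]
  · intro τ τ' h
    exact Set.disjoint_left.2 fun s hs hs' => h (Subtype.ext (hs.symm.trans hs'))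
  · exact fun τ => hπ.measurableSet w _

/-- The length of the word reveals j, and its first m letters reveal i < b^m. Hence all digits
beyond the m-th, for all of the first b^m points together, come from different and therefore
independent permutations. -/
theorem word_injective (m : ℕ) : Function.Injective fun p : Fin (b ^ m) × ℕ =>
    (List.range (m + p.2)).map (baseDigits b p.1) := by
  rintro ⟨i, j⟩ ⟨i', j'⟩ h
  simp only at h
  have hj : j = j' := by simpa using congrArg List.length h
  subst hj
  have h1 : ∀ l < m, baseDigits b i l = baseDigits b i' l := fun l hl =>
    List.map_inj_left.1 h l (List.mem_range.2 (by omega))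
  have h2 := mod_eq_of_baseDigits_eq h1
  rw [Nat.mod_eq_of_lt i.isLt, Nat.mod_eq_of_lt i'.isLt] at h2
  rw [Fin.ext h2]

variable {π}

theorem IsUniformScrambling.iIndepFun_offset [IsProbabilityMeasure P]
    (hπ : IsUniformScrambling P π) (m : ℕ) :
    iIndepFun (fun (i : Fin (b ^ m)) s => offset π m i s) P := by
  have h1 : iIndepFun (fun p : Fin (b ^ m) × ℕ => scrambledDigit π p.1 (m + p.2)) P :=
    (hπ.indep.precomp (word_injective m)).comp
      (fun p τ => τ (baseDigits b p.1 (m + p.2))) fun _ => measurable_from_top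
  have h2 := iIndepFun_curry (fun p => hπ.measurable_scrambledDigit _ _) h1
  exact h2.comp (fun _ => Real.ofDigits) fun _ => Real.continuous_ofDigits.measurable

theorem IsUniformScrambling.measurable_offset (hπ : IsUniformScrambling P π) (m i : ℕ) :
    Measurable (offset π m i) :=
  measurable_ofDigits fun _ => hπ.measurable_scrambledDigit _ _

theorem IsUniformScrambling.map_offset [IsProbabilityMeasure P] (hb : 2 ≤ b)
    (hπ : IsUniformScrambling P π) (m : ℕ) (i : Fin (b ^ m)) :
    P.map (offset π m i) = unif := by
  refine map_ofDigits hb (fun _ => hπ.measurable_scrambledDigit _ _)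
    (fun _ => hπ.scrambledDigit_uniform _ _) ?_
  exact (hπ.indep.precomp ((word_injective m).comp
    (Prod.mk_right_injective i : Function.Injective fun j : ℕ => (i, j)))).comp
      (fun j τ => τ (baseDigits b i (m + j))) fun _ => measurable_from_top

/-- The positions of the scrambled points in their intervals of length `b ^ (-m)`, listed
in the order of the intervals, are independent and uniformly distributed. -/
theorem IsUniformScrambling.measurePreserving_offset [IsProbabilityMeasure P] (hb : 2 ≤ b)
    (hπ : IsUniformScrambling P π) (m : ℕ) :
    MeasurePreserving (fun s (k : Fin (b ^ m)) => offset π m ((stratumPerm π m s).symm k) s) P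
      (Measure.pi fun _ => unif) := by
  let mPerm : MeasurableSpace (Equiv.Perm (Fin b)) := ⊤
  have hV : Measurable fun s (i : Fin (b ^ m)) => offset π m i s :=
    measurable_pi_lambda _ fun i => hπ.measurable_offset m i
  -- Words shorter than m generate `stratumPerm`; words of length at least m generate the offsets.
  -- The two families are disjoint, which gives the independence that `map_comp_randomPerm` needs.
  have hindep := indep_iSup_of_disjoint (m := fun w => mPerm.comap (π w))
    (fun w => (hπ.measurable w).comap_le) hπ.indep
    (S := {w | w.length < m}) (T := {w | m ≤ w.length})
    (Set.disjoint_left.2 fun w h h' => by simp at h h'; omega)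
  have hdig (T : Set (List (Fin b))) (i j : ℕ) (h : (List.range j).map (baseDigits b i) ∈ T) :
      Measurable[⨆ w ∈ T, mPerm.comap (π w)] (scrambledDigit π i j) := by
    have h1 : mPerm.comap (π ((List.range j).map (baseDigits b i))) ≤
        ⨆ w ∈ T, mPerm.comap (π w) := le_iSup₂_of_le _ h le_rfl
    have h2 : Measurable[mPerm.comap (π ((List.range j).map (baseDigits b i)))]
        (π ((List.range j).map (baseDigits b i))) := comap_measurable _
    exact ((measurable_from_top (f := fun τ : Equiv.Perm (Fin b) => τ (baseDigits b i j))).comp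
      h2).mono h1 le_rfl
  have hτ (σ : Equiv.Perm (Fin (b ^ m))) :
      MeasurableSet[⨆ w ∈ {w : List (Fin b) | w.length < m}, mPerm.comap (π w)]
        {s | stratumPerm π m s = σ} := by
    have h1 (i : ℕ) : ∀ l ≤ m, Measurable[⨆ w ∈ {w : List (Fin b) | w.length < m},
        mPerm.comap (π w)] fun s => stratum π i s l := by
      intro l
      induction l with
      | zero => intro _; exact @measurable_const _ _ _ (_) _
      | succ l ih =>
        intro hl
        have h2 := hdig {w | w.length < m} i l (by simp; omega)
        have h3 := ih (by omega)
        exact (@Measurable.add _ _ _ _ _ (_) _ _ (@Measurable.mul_const _ _ _ _ _ (_) _ h3 b)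
          ((measurable_of_finite (fun a : Fin b => (a : ℕ))).comp h2))
    have h4 : {s | stratumPerm π m s = σ} =
        ⋂ i : Fin (b ^ m), (fun s => stratum π i s m) ⁻¹' {(σ i : ℕ)} := by
      ext s
      simp [Equiv.ext_iff, Fin.ext_iff, val_stratumPerm]
    rw [h4]
    exact @MeasurableSet.iInter _ _ (_) _ _ fun i => h1 i m le_rfl (measurableSet_singleton _)
  have hV' : Measurable[⨆ w ∈ {w : List (Fin b) | m ≤ w.length}, mPerm.comap (π w)]
      fun s (i : Fin (b ^ m)) => offset π m i s := by
    refine @measurable_pi_lambda _ _ _ (_) _ _ fun i => ?_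
    exact @measurable_ofDigits S (_) b (fun j => scrambledDigit π i (m + j))
      fun j => hdig _ _ _ (by simp)
  have hle : (⨆ w ∈ {w : List (Fin b) | w.length < m}, mPerm.comap (π w)) ≤ ‹MeasurableSpace S› :=
    iSup₂_le fun w _ => (hπ.measurable w).comap_le
  refine map_comp_randomPerm unif hV ?_ (fun σ => hle _ (hτ σ)) fun σ B hB => ?_
  · rw [(iIndepFun_iff_map_fun_eq_pi_map fun i => (hπ.measurable_offset m _).aemeasurable).1
      (hπ.iIndepFun_offset m)]
    simp_rw [hπ.map_offset hb]
  · exact (Indep_iff _ _ _).1 hindep _ _ (hτ σ) (hV' hB)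

end Scrambling

/-! ### A quantitative central limit theorem for bounded summands -/

/-- Lindeberg's replacement: the factors are exchanged one at a time, while the others have modulus
at most 1. -/
theorem norm_prod_sub_prod_le {ι : Type*} (s : Finset ι) (a c : ι → ℂ)
    (ha : ∀ i ∈ s, ‖a i‖ ≤ 1) (hc : ∀ i ∈ s, ‖c i‖ ≤ 1) :
    ‖∏ i ∈ s, a i - ∏ i ∈ s, c i‖ ≤ ∑ i ∈ s, ‖a i - c i‖ := by
  classical
  induction s using Finset.induction_on with
  | empty => simp
  | insert i s hi ih =>
    rw [Finset.prod_insert hi, Finset.prod_insert hi, Finset.sum_insert hi]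
    have h1 := ih (fun j hj => ha j (Finset.mem_insert_of_mem hj))
      (fun j hj => hc j (Finset.mem_insert_of_mem hj))
    have h2 : ‖∏ j ∈ s, c j‖ ≤ 1 := by
      rw [norm_prod]
      exact Finset.prod_le_one (fun _ _ => norm_nonneg _)
        fun j hj => hc j (Finset.mem_insert_of_mem hj)
    calc ‖a i * ∏ j ∈ s, a j - c i * ∏ j ∈ s, c j‖
        = ‖(a i - c i) * ∏ j ∈ s, c j + a i * (∏ j ∈ s, a j - ∏ j ∈ s, c j)‖ := by ring_nf
      _ ≤ ‖a i - c i‖ * ‖∏ j ∈ s, c j‖ + ‖a i‖ * ‖∏ j ∈ s, a j - ∏ j ∈ s, c j‖ := by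
        rw [← norm_mul, ← norm_mul]
        exact norm_add_le _ _
      _ ≤ ‖a i - c i‖ * 1 + 1 * ‖∏ j ∈ s, a j - ∏ j ∈ s, c j‖ := by
        gcongr
        exact ha i (Finset.mem_insert_self _ _)
      _ ≤ _ := by linarith

theorem norm_exp_mul_I_sub_le {z : ℝ} (hz : |z| ≤ 1) :
    ‖Complex.exp (z * Complex.I) - (1 + z * Complex.I - z ^ 2 / 2)‖ ≤ |z| ^ 3 := by
  have hn : ‖(z : ℂ) * Complex.I‖ = |z| := by simp
  have h := Complex.exp_bound (x := z * Complex.I) (by rw [hn]; exact hz) (n := 3) (by norm_num)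
  rw [hn] at h
  have e : ∑ m ∈ Finset.range 3, (z * Complex.I) ^ m / (m.factorial : ℂ) =
      1 + z * Complex.I - z ^ 2 / 2 := by
    simp [Finset.sum_range_succ, mul_pow, Nat.factorial]
    ring
  rw [e] at h
  refine h.trans ?_
  have : 0 ≤ |z| ^ 3 := by positivity
  norm_num [Nat.factorial]
  linarith

section


variable {S : Type*} [MeasurableSpace S] {P : Measure S} [IsProbabilityMeasure P]

/-- The characteristic function of a small centred variable is close to that of the normal
variable with the same variance. -/
theorem norm_charFun_sub_exp_le {Y : S → ℝ} (hY : Measurable Y) {ε t : ℝ} (hε : ∀ s, |Y s| ≤ ε)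
    (hmean : ∫ s, Y s ∂P = 0) (ht : |t| * ε ≤ 1) :
    ‖charFun (P.map Y) t - Real.exp (-(t ^ 2 * (∫ s, Y s ^ 2 ∂P) / 2))‖ ≤
      (|t| ^ 3 * ε + t ^ 4 * ε ^ 2) * ∫ s, Y s ^ 2 ∂P := by
  obtain ⟨s₀⟩ : Nonempty S := by
    by_contra h
    rw [not_nonempty_iff] at h
    have := measure_univ (μ := P)
    simp [Set.univ_eq_empty_iff.2 h] at this
  have hε0 : 0 ≤ ε := (abs_nonneg _).trans (hε s₀)
  have hb (s : S) : Y s ^ 2 ≤ ε ^ 2 := sq_le_sq' (abs_le.1 (hε s)).1 (abs_le.1 (hε s)).2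
  have i1 : Integrable Y P := Integrable.of_bound hY.aestronglyMeasurable ε (ae_of_all _ hε)
  have i2 : Integrable (fun s => Y s ^ 2) P :=
    Integrable.of_bound (hY.pow_const 2).aestronglyMeasurable (ε ^ 2) (ae_of_all _ fun s => by
      rw [Real.norm_of_nonneg (sq_nonneg _)]; exact hb s)
  set v := ∫ s, Y s ^ 2 ∂P with hv
  have hv0 : 0 ≤ v := integral_nonneg fun s => sq_nonneg _
  have hve : v ≤ ε ^ 2 := by
    calc v ≤ ∫ _, ε ^ 2 ∂P := integral_mono i2 (integrable_const _) hb
      _ = ε ^ 2 := by simp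
  have hexp : Measurable fun s => Complex.exp (t * Y s * Complex.I) := by fun_prop
  have i3 : Integrable (fun s => Complex.exp (t * Y s * Complex.I)) P :=
    Integrable.of_bound hexp.aestronglyMeasurable 1 (ae_of_all _ fun s => by
      rw [← Complex.ofReal_mul, Complex.norm_exp_ofReal_mul_I])
  have i4 : Integrable (fun s => 1 + ((t * Y s : ℝ) : ℂ) * Complex.I - ((t * Y s : ℝ) : ℂ) ^ 2 / 2) P := by
    have h1 : Integrable (fun s => ((t * Y s : ℝ) : ℂ) * Complex.I) P :=
      ((i1.const_mul t).ofReal).mul_const _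
    have h2 : Integrable (fun s => ((t * Y s : ℝ) : ℂ) ^ 2 / 2) P := by
      have := ((i2.const_mul (t ^ 2 / 2)).ofReal (𝕜 := ℂ))
      refine this.congr (ae_of_all _ fun s => ?_)
      simp only [Complex.coe_algebraMap]
      push_cast
      ring
    exact ((integrable_const _).add h1).sub h2
  have e4 : ∫ s, (1 + ((t * Y s : ℝ) : ℂ) * Complex.I - ((t * Y s : ℝ) : ℂ) ^ 2 / 2) ∂P =
      ((1 - t ^ 2 * v / 2 : ℝ) : ℂ) := by
    have h1 : Integrable (fun s => ((t * Y s : ℝ) : ℂ) * Complex.I) P :=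
      ((i1.const_mul t).ofReal).mul_const _
    have e2 : (fun s => ((t * Y s : ℝ) : ℂ) ^ 2 / 2) = fun s => ((t ^ 2 / 2 * Y s ^ 2 : ℝ) : ℂ) := by
      ext s
      push_cast
      ring
    have h2 : Integrable (fun s => ((t * Y s : ℝ) : ℂ) ^ 2 / 2) P := by
      rw [e2]
      exact ((i2.const_mul (t ^ 2 / 2)).ofReal (𝕜 := ℂ))
    have h3 : Integrable (fun s => 1 + ((t * Y s : ℝ) : ℂ) * Complex.I) P :=
      (integrable_const _).add h1
    rw [integral_sub h3 h2, integral_add (integrable_const _) h1, e2,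
      integral_mul_const, integral_complex_ofReal, integral_complex_ofReal, integral_const_mul,
      integral_const_mul, hmean, ← hv]
    simp
    ring
  -- In the cubic Taylor remainder one factor |Y| is bounded by ε and the other two are kept, so
  -- that the error is proportional to the variance.
  have step1 : ‖charFun (P.map Y) t - ((1 - t ^ 2 * v / 2 : ℝ) : ℂ)‖ ≤ |t| ^ 3 * ε * v := by
    rw [charFun_apply_real, integral_map hY.aemeasurable (by fun_prop), ← e4, ← integral_sub i3 i4]
    have hpt (s : S) : ‖Complex.exp (t * Y s * Complex.I) -
        (1 + ((t * Y s : ℝ) : ℂ) * Complex.I - ((t * Y s : ℝ) : ℂ) ^ 2 / 2)‖ ≤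
          |t| ^ 3 * ε * Y s ^ 2 := by
      have hz : |t * Y s| ≤ 1 := by
        rw [abs_mul]
        exact (mul_le_mul_of_nonneg_left (hε s) (abs_nonneg _)).trans ht
      have h := norm_exp_mul_I_sub_le hz
      rw [Complex.ofReal_mul] at h ⊢
      refine h.trans ?_
      rw [abs_mul, mul_pow, mul_assoc, pow_succ |Y s| 2, sq_abs, mul_comm (Y s ^ 2)]
      gcongr
      exact hε s
    calc _ ≤ ∫ s, |t| ^ 3 * ε * Y s ^ 2 ∂P :=
          norm_integral_le_of_norm_le (i2.const_mul _) (ae_of_all _ hpt)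
      _ = _ := integral_const_mul _ _
  -- The quadratic error contains v², of which one factor is bounded by ε²; again a multiple of v
  -- remains.
  have step2 : ‖((1 - t ^ 2 * v / 2 : ℝ) : ℂ) - (Real.exp (-(t ^ 2 * v / 2)) : ℂ)‖ ≤
      t ^ 4 * ε ^ 2 * v := by
    rw [← Complex.ofReal_sub, Complex.norm_real, Real.norm_eq_abs, abs_sub_comm]
    have hx0 : 0 ≤ t ^ 2 * v / 2 := by positivity
    have hx1 : t ^ 2 * v ≤ (|t| * ε) ^ 2 := by
      rw [mul_pow, sq_abs]
      gcongr
    have hx2 : (|t| * ε) ^ 2 ≤ 1 := pow_le_one₀ (by positivity) ht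
    have h := Real.abs_exp_sub_one_sub_id_le (x := -(t ^ 2 * v / 2))
      (by rw [abs_neg, abs_of_nonneg hx0]; linarith)
    calc |Real.exp (-(t ^ 2 * v / 2)) - (1 - t ^ 2 * v / 2)|
        = |Real.exp (-(t ^ 2 * v / 2)) - 1 - -(t ^ 2 * v / 2)| := by ring_nf
      _ ≤ (-(t ^ 2 * v / 2)) ^ 2 := h
      _ = t ^ 4 * v * v / 4 := by ring
      _ ≤ t ^ 4 * ε ^ 2 * v / 4 := by gcongr
      _ ≤ t ^ 4 * ε ^ 2 * v := by
        have : 0 ≤ t ^ 4 * ε ^ 2 * v := by positivity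
        linarith
  calc _ ≤ _ := norm_sub_le_norm_sub_add_norm_sub _ ((1 - t ^ 2 * v / 2 : ℝ) : ℂ) _
    _ ≤ |t| ^ 3 * ε * v + t ^ 4 * ε ^ 2 * v := add_le_add step1 step2
    _ = _ := by ring

/-- Each exchange of a factor costs a multiple of the variance of that summand. The costs add up to
the total variance 1, so the bound does not depend on n. -/
theorem norm_charFun_sum_sub_exp_le {n : ℕ} {Y : Fin n → S → ℝ} (hY : ∀ k, Measurable (Y k))
    (hind : iIndepFun Y P) {ε t : ℝ} (hε : ∀ k s, |Y k s| ≤ ε) (hmean : ∀ k, ∫ s, Y k s ∂P = 0)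
    (hvar : ∑ k, ∫ s, Y k s ^ 2 ∂P = 1) (ht : |t| * ε ≤ 1) :
    ‖charFun (P.map (∑ k, Y k)) t - Real.exp (-(t ^ 2 / 2))‖ ≤ |t| ^ 3 * ε + t ^ 4 * ε ^ 2 := by
  have h1 : charFun (P.map (∑ k, Y k)) t = ∏ k, charFun (P.map (Y k)) t := by
    rw [iIndepFun.charFun_map_finsetSum_eq_prod (fun j _ => (hY j).aemeasurable)
      (hind.precomp (g := fun j : (Finset.univ : Finset (Fin n)) => (j : Fin n))
        Subtype.val_injective), Finset.prod_apply]
  have h2 : (Real.exp (-(t ^ 2 / 2)) : ℂ) =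
      ∏ k, (Real.exp (-(t ^ 2 * (∫ s, Y k s ^ 2 ∂P) / 2)) : ℂ) := by
    rw [← Complex.ofReal_prod, ← Real.exp_sum, Finset.sum_neg_distrib, ← Finset.sum_div,
      ← Finset.mul_sum, hvar, mul_one]
  have hp (k : Fin n) : IsProbabilityMeasure (P.map (Y k)) :=
    Measure.isProbabilityMeasure_map (hY k).aemeasurable
  rw [h1, h2]
  refine (norm_prod_sub_prod_le _ _ _ (fun k _ => norm_charFun_le_one t) fun k _ => ?_).trans ?_
  · rw [Complex.norm_real, Real.norm_of_nonneg (Real.exp_pos _).le, Real.exp_le_one_iff]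
    have : 0 ≤ ∫ s, Y k s ^ 2 ∂P := integral_nonneg fun s => sq_nonneg _
    have : 0 ≤ t ^ 2 * (∫ s, Y k s ^ 2 ∂P) / 2 := by positivity
    linarith
  · refine (Finset.sum_le_sum fun k _ => norm_charFun_sub_exp_le (hY k) (hε k) (hmean k) ht).trans ?_
    rw [← Finset.mul_sum, hvar, mul_one]

end

theorem variance_stratifiedMean {F : ℝ → ℝ} (hF : Measurable F) {M : ℝ} (hM : ∀ x, |F x| ≤ M)
    {n : ℕ} (hn : 0 < n) :
    (n : ℝ) ^ 2 * Var[stratifiedMean F n; Measure.pi fun _ => unif] =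
      ∑ k : Fin n, Var[fun v => F ((k + v) / n); unif] := by
  have hn0 : (n : ℝ) ≠ 0 := by positivity
  have hX (k : Fin n) : MemLp (fun v : ℝ => F ((k + v) / n)) 2 unif :=
    MemLp.of_bound (hF.comp (by fun_prop)).aestronglyMeasurable M (ae_of_all _ fun v => hM _)
  have hstr : stratifiedMean F n =
      (1 / (n : ℝ)) • ∑ k : Fin n, fun v : Fin n → ℝ => F ((k + v k) / n) := by
    ext v
    simp [stratifiedMean]
  rw [hstr, variance_smul, variance_sum_pi hX]
  field_simp

/-- The **central limit theorem** for stratified means of a bounded function, if the variance of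
the sum over the strata tends to infinity. -/
theorem tendsto_charFun_stratifiedMean {F : ℝ → ℝ} (hF : Measurable F) {M : ℝ}
    (hM : ∀ x, |F x| ≤ M) {N : ℕ → ℕ} (hN : ∀ m, 0 < N m) {V : ℕ → ℝ}
    (hV : ∀ m, V m = Var[stratifiedMean F (N m); Measure.pi fun _ => unif])
    (hinf : Tendsto (fun m => (N m : ℝ) ^ 2 * V m) atTop atTop) (t : ℝ) :
    Tendsto (fun m => charFun ((Measure.pi fun _ : Fin (N m) => unif).map fun v =>
      (stratifiedMean F (N m) v - ∫ x, F x ∂unif) / √(V m)) t) atTop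
        (𝓝 (charFun (gaussianReal 0 1) t)) := by
  have hg : charFun (gaussianReal 0 1) t = Real.exp (-(t ^ 2 / 2)) := by
    rw [charFun_gaussianReal]
    simp
  have hM0 : 0 ≤ M := (abs_nonneg _).trans (hM 0)
  rw [hg, tendsto_iff_norm_sub_tendsto_zero]
  -- This is a uniform bound for the standardised summands: values and stratum means are at most M
  -- in modulus, and the sum over the strata has variance N² V. Its convergence to 0 plays the role
  -- of the Lindeberg condition.
  have hε : Tendsto (fun m => 2 * M / √((N m : ℝ) ^ 2 * V m)) atTop (𝓝 0) :=
    tendsto_const_nhds.div_atTop (Real.tendsto_sqrt_atTop.comp hinf)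
  have hlim : Tendsto (fun m => |t| ^ 3 * (2 * M / √((N m : ℝ) ^ 2 * V m)) +
      t ^ 4 * (2 * M / √((N m : ℝ) ^ 2 * V m)) ^ 2) atTop (𝓝 0) := by
    have := (hε.const_mul (|t| ^ 3)).add ((hε.pow 2).const_mul (t ^ 4))
    simpa using this
  refine squeeze_zero' (Eventually.of_forall fun _ => norm_nonneg _) ?_ hlim
  have ht1 : Tendsto (fun m => |t| * (2 * M / √((N m : ℝ) ^ 2 * V m))) atTop (𝓝 0) := by
    simpa using hε.const_mul |t|
  filter_upwards [hinf.eventually_gt_atTop 0, ht1.eventually_le_const one_pos] with m hpos ht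
  set n := N m with hn
  have hn0 : 0 < (n : ℝ) := by exact_mod_cast hN m
  set a : ℝ := √((n : ℝ) ^ 2 * V m) with ha
  have ha0 : 0 < a := Real.sqrt_pos.2 hpos
  have hVpos : 0 < V m := pos_of_mul_pos_right hpos (by positivity)
  have ha' : a = n * √(V m) := by rw [ha, Real.sqrt_mul (by positivity), Real.sqrt_sq hn0.le]
  let μ : Fin n → ℝ := fun k => ∫ v, F ((k + v) / n) ∂unif
  let X : Fin n → ℝ → ℝ := fun k v => F ((k + v) / n)
  have hXm (k : Fin n) : Measurable (X k) := hF.comp (by fun_prop)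
  have hX2 (k : Fin n) : MemLp (X k) 2 unif :=
    MemLp.of_bound (hXm k).aestronglyMeasurable M (ae_of_all _ fun v => hM _)
  have hμ (k : Fin n) : |μ k| ≤ M := by
    have := norm_integral_le_of_norm_le_const (μ := unif) (f := X k) (C := M) (ae_of_all _ fun v => hM _)
    simpa using this
  have hsum : ∑ k, μ k = n * ∫ x, F x ∂unif := by
    rw [integral_unif_split (n := n) (Integrable.of_bound hF.aestronglyMeasurable M
      (ae_of_all _ hM)) (hN m), Finset.sum_range, smul_eq_mul, ← mul_assoc,
      mul_inv_cancel₀ hn0.ne', one_mul]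
  have hVar : (n : ℝ) ^ 2 * V m = ∑ k, Var[X k; unif] := by
    rw [hV, ← hn, variance_stratifiedMean hF hM (hN m)]
  let Y : Fin n → (Fin n → ℝ) → ℝ := fun k v => (X k (v k) - μ k) / a
  have hYm (k : Fin n) : Measurable (Y k) :=
    (((hXm k).comp (measurable_pi_apply k)).sub_const _).div_const _
  have hYind : iIndepFun Y (Measure.pi fun _ => unif) :=
    iIndepFun_pi (X := fun k v => (X k v - μ k) / a)
      fun k => (((hXm k).sub_const _).div_const _).aemeasurable
  have hYb (k : Fin n) (v : Fin n → ℝ) : |Y k v| ≤ 2 * M / a := by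
    simp only [Y]
    rw [abs_div, abs_of_pos ha0]
    gcongr
    have h1 := hM ((k + v k) / n)
    have h2 := hμ k
    calc |X k (v k) - μ k| ≤ |X k (v k)| + |μ k| := abs_sub _ _
      _ ≤ 2 * M := by linarith
  have hYmean (k : Fin n) : ∫ v, Y k v ∂(Measure.pi fun _ => unif) = 0 := by
    rw [integral_comp_eval (μ := fun _ : Fin n => unif) (i := k) (f := fun v => (X k v - μ k) / a)
      (((hXm k).sub_const _).div_const _).aestronglyMeasurable, integral_div,
      integral_sub ((hX2 k).integrable (by norm_num)) (integrable_const _)]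
    simp [μ, X]
  have hYvar : ∑ k, ∫ v, Y k v ^ 2 ∂(Measure.pi fun _ => unif) = 1 := by
    have h1 (k : Fin n) : ∫ v, Y k v ^ 2 ∂(Measure.pi fun _ => unif) =
        Var[X k; unif] / a ^ 2 := by
      rw [integral_comp_eval (μ := fun _ : Fin n => unif) (i := k)
        (f := fun v => ((X k v - μ k) / a) ^ 2)
        ((((hXm k).sub_const _).div_const _).pow_const 2).aestronglyMeasurable,
        variance_eq_integral (hXm k).aemeasurable, ← integral_div]
      simp [div_pow, μ, X]
    simp_rw [h1]
    rw [← Finset.sum_div, ← hVar, ha, Real.sq_sqrt hpos.le, div_self hpos.ne']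
  have hmain := norm_charFun_sum_sub_exp_le hYm hYind hYb hYmean hYvar ht
  have hfun : (fun v => (stratifiedMean F n v - ∫ x, F x ∂unif) / √(V m)) = ∑ k, Y k := by
    ext v
    have hs : √(V m) ≠ 0 := (Real.sqrt_pos.2 hVpos).ne'
    simp only [Finset.sum_apply, Y]
    rw [← Finset.sum_div, Finset.sum_sub_distrib, hsum, ha', stratifiedMean]
    field_simp
    rfl
  rw [hfun]
  exact hmain

/-! ### Equidistributed slots -/

/-- The number of the interval `[k / N, (k + 1) / N)` that contains `x`. -/
noncomputable def slot (N : ℕ) [NeZero N] (x : ℝ) : Fin N :=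
  ⟨min ⌊N * x⌋₊ (N - 1), by have := NeZero.pos N; omega⟩

theorem measurable_slot (N : ℕ) [NeZero N] : Measurable (slot N) := by
  refine measurable_to_countable' fun a => ?_
  have : slot N ⁻¹' {a} = (fun x : ℝ => min ⌊N * x⌋₊ (N - 1)) ⁻¹' {(a : ℕ)} := by
    ext x
    simp [slot, Fin.ext_iff]
  rw [this]
  exact ((Nat.measurable_floor.comp (measurable_const_mul _)).min measurable_const)
    (measurableSet_singleton _)

theorem slot_stratum {N : ℕ} [NeZero N] {k : ℕ} (hk : k < N) {v : ℝ} (hv : v ∈ Set.Ico (0 : ℝ) 1) :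
    slot N ((k + v) / N) = ⟨k, hk⟩ := by
  have hN : (N : ℝ) ≠ 0 := by exact_mod_cast NeZero.ne N
  have : ⌊(N : ℝ) * ((k + v) / N)⌋₊ = k := by
    rw [mul_div_cancel₀ _ hN, Nat.floor_eq_iff (by have := hv.1; positivity)]
    exact ⟨by linarith [hv.1], by linarith [hv.2]⟩
  simp only [slot, this, Fin.mk.injEq]
  omega

theorem slot_bounds (N : ℕ) [NeZero N] {x : ℝ} (hx : x ∈ Set.Icc (0 : ℝ) 1) :
    (slot N x : ℝ) ≤ N * x ∧ N * x ≤ slot N x + 1 := by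
  have hN : 0 < N := NeZero.pos N
  have hx0 : 0 ≤ N * x := mul_nonneg (by positivity) hx.1
  have h1 := Nat.floor_le hx0
  have h2 := Nat.lt_floor_add_one (N * x)
  rcases le_total ⌊N * x⌋₊ (N - 1) with h | h
  · have : (slot N x : ℕ) = ⌊N * x⌋₊ := min_eq_left h
    rw [this]
    exact ⟨h1, h2.le⟩
  · have : (slot N x : ℕ) = N - 1 := min_eq_right h
    rw [this]
    refine ⟨le_trans (by exact_mod_cast h) h1, ?_⟩
    rw [Nat.cast_sub (by omega)]
    have : (N : ℝ) * x ≤ N * 1 := by gcongr; exact hx.2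
    push_cast
    linarith

theorem ae_unif_mem : ∀ᵐ x ∂unif, x ∈ Set.Ioo (0 : ℝ) 1 := by
  have h : unif = volume.restrict (Set.Ioo 0 1) := Measure.restrict_congr_set Ioo_ae_eq_Icc.symm
  rw [h]
  exact ae_restrict_mem measurableSet_Ioo

theorem integral_slot {N : ℕ} [NeZero N] (ψ : Fin N → ℝ) :
    ∫ x, ψ (slot N x) ∂unif = (N : ℝ)⁻¹ * ∑ k, ψ k := by
  have hi : Integrable (fun x => ψ (slot N x)) unif := by
    obtain ⟨M, hM⟩ : ∃ M, ∀ k, ‖ψ k‖ ≤ M := by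
      refine ⟨∑ k, ‖ψ k‖, fun k => ?_⟩
      exact Finset.single_le_sum (f := fun k => ‖ψ k‖) (fun _ _ => norm_nonneg _) (Finset.mem_univ k)
    exact Integrable.of_bound ((measurable_of_finite ψ).comp (measurable_slot N)).aestronglyMeasurable
      M (ae_of_all _ fun x => hM _)
  rw [integral_unif_split hi (NeZero.pos N), smul_eq_mul, Finset.sum_range]
  congr 1
  refine Finset.sum_congr rfl fun k _ => ?_
  have : (fun v => ψ (slot N ((k + v) / N))) =ᵐ[unif] fun _ => ψ k := by
    filter_upwards [ae_unif_mem] with v hv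
    rw [slot_stratum k.isLt ⟨hv.1.le, hv.2⟩]
  rw [integral_congr_ae this]
  simp

theorem map_slot_singleton {N : ℕ} [NeZero N] (a : Fin N) : (unif.map (slot N)).real {a} = (N : ℝ)⁻¹ := by
  have h := integral_slot (N := N) (Set.indicator {a} 1)
  have h1 : ∫ x, Set.indicator {a} (1 : Fin N → ℝ) (slot N x) ∂unif =
      ∫ y, Set.indicator {a} (1 : Fin N → ℝ) y ∂(unif.map (slot N)) :=
    (integral_map (measurable_slot N).aemeasurable
      (measurable_of_finite _).aestronglyMeasurable).symm
  rw [h1, integral_indicator_one (measurableSet_singleton a)] at h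
  rw [h]
  simp [Set.indicator_apply]

theorem integral_slot_pi {N d : ℕ} [NeZero N] (ψ : (Fin d → Fin N) → ℝ) :
    ∫ v, ψ (fun j => slot N (v j)) ∂(Measure.pi fun _ : Fin d => unif) =
      ((N : ℝ) ^ d)⁻¹ * ∑ c, ψ c := by
  have hp : IsProbabilityMeasure (unif.map (slot N)) :=
    Measure.isProbabilityMeasure_map (measurable_slot N).aemeasurable
  have h1 := Measure.pi_map_pi (μ := fun _ : Fin d => unif) (f := fun _ => slot N)
    fun _ => (measurable_slot N).aemeasurable
  have hm : Measurable fun (v : Fin d → ℝ) j => slot N (v j) :=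
    measurable_pi_lambda _ fun j => (measurable_slot N).comp (measurable_pi_apply j)
  rw [← integral_map (f := ψ) hm.aemeasurable (measurable_of_finite _).aestronglyMeasurable, h1,
    integral_fintype Integrable.of_finite, Finset.mul_sum]
  refine Finset.sum_congr rfl fun c _ => ?_
  have : (Measure.pi fun _ : Fin d => unif.map (slot N)).real {c} = ((N : ℝ) ^ d)⁻¹ := by
    rw [Measure.real, Measure.pi_singleton, ENNReal.toReal_prod]
    have h2 := fun j => map_slot_singleton (c j)
    simp only [Measure.real] at h2
    simp [h2]
  rw [this, smul_eq_mul]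

/-! ### Geometry of the Hilbert curve -/

section Geometry

variable {d : ℕ} {cell : ℕ → ℕ → Fin d → ℕ}

theorem val_slot_eq_timeIndex (d m : ℕ) (x : ℝ) :
    (slot (2 ^ (d * m)) x : ℕ) = timeIndex d m x := by
  simp [slot, timeIndex]

/-- The cubes visited at time x are nested: their lower corners increase and their upper corners
decrease with the level. The centres of all finer cubes thus stay in the closed cube of level m, and
so does their limit. -/
theorem hilbertCurve_mem_cell (h : IsHilbertOrder d cell) (m : ℕ) (x : ℝ) (j : Fin d) :
    (cell m (timeIndex d m x) j / 2 ^ m : ℝ) ≤ hilbertCurve d cell x j ∧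
      hilbertCurve d cell x j ≤ (cell m (timeIndex d m x) j + 1) / 2 ^ m := by
  have hn (m : ℕ) : cell (m + 1) (timeIndex d (m + 1) x) j = 2 * cell m (timeIndex d m x) j ∨
      cell (m + 1) (timeIndex d (m + 1) x) j = 2 * cell m (timeIndex d m x) j + 1 := by
    have hn := h.nested m _ (timeIndex_lt d (m + 1) x) j
    rw [timeIndex_succ] at hn
    omega
  have hlo : Monotone fun m => (cell m (timeIndex d m x) j / 2 ^ m : ℝ) := by
    refine monotone_nat_of_le_succ fun m => ?_
    rw [div_le_div_iff₀ (by positivity) (by positivity), pow_succ]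
    have hp : (0 : ℝ) < 2 ^ m := by positivity
    rcases hn m with e | e <;> rw [e] <;> push_cast <;> nlinarith
  have hhi : Antitone fun m => ((cell m (timeIndex d m x) j + 1) / 2 ^ m : ℝ) := by
    refine antitone_nat_of_succ_le fun m => ?_
    rw [div_le_div_iff₀ (by positivity) (by positivity), pow_succ]
    have hp : (0 : ℝ) < 2 ^ m := by positivity
    rcases hn m with e | e <;> rw [e] <;> push_cast <;> nlinarith
  have ht : Tendsto (fun m => approxCurve d cell m x j) atTop (𝓝 (hilbertCurve d cell x j)) :=
    ((EuclideanSpace.proj (𝕜 := ℝ) j).continuous.tendsto _).comp (tendsto_approxCurve h x)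
  constructor
  · refine ge_of_tendsto ht (eventually_atTop.2 ⟨m, fun m' hm => (hlo hm).trans ?_⟩)
    simp only [approxCurve]
    gcongr
    linarith
  · refine le_of_tendsto ht (eventually_atTop.2 ⟨m, fun m' hm => le_trans ?_ (hhi hm)⟩)
    simp only [approxCurve]
    gcongr
    norm_num

theorem hilbertCurve_mem_unitCube (h : IsHilbertOrder d cell) (x : ℝ) :
    hilbertCurve d cell x ∈ unitCube d := fun j => by
  have := hilbertCurve_mem_cell h 0 x j
  have h0 : timeIndex d 0 x = 0 := by simpa using timeIndex_lt d 0 x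
  simpa [h0, h.start] using this

theorem timeIndex_mono (d m : ℕ) {x y : ℝ} (hxy : x ≤ y) : timeIndex d m x ≤ timeIndex d m y :=
  min_le_min_right _ (Nat.floor_mono (by gcongr))

theorem timeIndex_le_succ (d m : ℕ) {x y : ℝ} (hxy : y ≤ x + 1 / 2 ^ (d * m)) :
    timeIndex d m y ≤ timeIndex d m x + 1 := by
  have hp : (0 : ℝ) < 2 ^ (d * m) := by positivity
  have h1 : (2 : ℝ) ^ (d * m) * y ≤ 2 ^ (d * m) * x + 1 := by
    calc (2 : ℝ) ^ (d * m) * y ≤ 2 ^ (d * m) * (x + 1 / 2 ^ (d * m)) := by gcongr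
      _ = _ := by field_simp
  have h2 : ⌊(2 : ℝ) ^ (d * m) * y⌋₊ ≤ ⌊(2 : ℝ) ^ (d * m) * x⌋₊ + 1 := by
    rcases le_or_gt 0 ((2 : ℝ) ^ (d * m) * x) with h0 | h0
    · rw [← Nat.floor_add_one h0]
      exact Nat.floor_mono h1
    -- For negative x the natural floor is 0, and the scaled y is below 1.
    · have : ⌊(2 : ℝ) ^ (d * m) * y⌋₊ ≤ 1 := Nat.floor_le_of_le (by push_cast; linarith)
      omega
  unfold timeIndex
  omega

/-- Such times belong to the same or to consecutive cubes of level m. Consecutive cubes share a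
facet, so each coordinate varies by at most two sides. -/
theorem abs_hilbertCurve_sub_le_of_le (h : IsHilbertOrder d cell) (m : ℕ) {x y : ℝ} (hxy : x ≤ y)
    (hyx : y ≤ x + 1 / 2 ^ (d * m)) (j : Fin d) :
    |hilbertCurve d cell x j - hilbertCurve d cell y j| ≤ 2 / 2 ^ m := by
  have hx := hilbertCurve_mem_cell h m x j
  have hy := hilbertCurve_mem_cell h m y j
  have h1 := timeIndex_mono d m hxy
  have h2 := timeIndex_le_succ d m hyx
  have h3 : (cell m (timeIndex d m x) j : ℝ) ≤ cell m (timeIndex d m y) j + 1 ∧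
      (cell m (timeIndex d m y) j : ℝ) ≤ cell m (timeIndex d m x) j + 1 := by
    rcases Nat.lt_or_ge (timeIndex d m x) (timeIndex d m y) with h4 | h4
    · have h5 : timeIndex d m y = timeIndex d m x + 1 := by omega
      obtain ⟨i, hi, hi'⟩ := h.adjacent m (timeIndex d m x) (h5 ▸ timeIndex_lt d m y)
      rw [h5]
      norm_cast
      by_cases hj : j = i
      · subst hj; omega
      · rw [hi' j hj]; omega
    · have h5 : timeIndex d m y = timeIndex d m x := by omega
      rw [h5]
      constructor <;> linarith
  have e (a : ℝ) : (a + 1) / 2 ^ m = a / 2 ^ m + 1 / 2 ^ m := add_div _ _ _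
  have h4 : (cell m (timeIndex d m x) j : ℝ) / 2 ^ m ≤ cell m (timeIndex d m y) j / 2 ^ m + 1 / 2 ^ m := by
    rw [← e]; gcongr; exact h3.1
  have h5 : (cell m (timeIndex d m y) j : ℝ) / 2 ^ m ≤ cell m (timeIndex d m x) j / 2 ^ m + 1 / 2 ^ m := by
    rw [← e]; gcongr; exact h3.2
  rw [e] at hx hy
  have e2 : (2 : ℝ) / 2 ^ m = 1 / 2 ^ m + 1 / 2 ^ m := by ring
  rw [e2, abs_le]
  constructor <;> linarith [hx.1, hx.2, hy.1, hy.2]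

theorem norm_le_of_abs_le {x : EuclideanSpace ℝ (Fin d)} {r : ℝ} (hr : 0 ≤ r)
    (hx : ∀ j, |x j| ≤ r) : ‖x‖ ≤ √d * r := by
  rw [EuclideanSpace.norm_eq, Real.sqrt_le_left (by positivity), mul_pow,
    Real.sq_sqrt (Nat.cast_nonneg d)]
  calc ∑ j, ‖x j‖ ^ 2 ≤ ∑ _j : Fin d, r ^ 2 :=
        Finset.sum_le_sum fun j _ => pow_le_pow_left₀ (norm_nonneg _) (hx j) 2
    _ = d * r ^ 2 := by simp

/-- Continuity holds on all of ℝ, since `timeIndex` clamps times outside [0,1] to the first or last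
interval. -/
theorem uniformContinuous_hilbertCurve (h : IsHilbertOrder d cell) :
    UniformContinuous (hilbertCurve d cell) := by
  rw [Metric.uniformContinuous_iff]
  intro ε hε
  have ht : Tendsto (fun m : ℕ => √d * (2 / 2 ^ m)) atTop (𝓝 0) := by
    have : Tendsto (fun m : ℕ => (2 : ℝ) / 2 ^ m) atTop (𝓝 0) :=
      tendsto_const_nhds.div_atTop (tendsto_pow_atTop_atTop_of_one_lt (by norm_num))
    simpa using this.const_mul (√d)
  obtain ⟨m, hm⟩ := (ht.eventually_lt_const hε).exists
  refine ⟨1 / 2 ^ (d * m), by positivity, fun {x y} hxy => ?_⟩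
  have key : ∀ x y : ℝ, x ≤ y → dist x y < 1 / 2 ^ (d * m) →
      dist (hilbertCurve d cell x) (hilbertCurve d cell y) < ε := by
    intro x y hle hxy
    rw [Real.dist_eq, abs_sub_comm, abs_of_nonneg (by linarith)] at hxy
    rw [dist_eq_norm]
    refine lt_of_le_of_lt (norm_le_of_abs_le (r := 2 / 2 ^ m) (by positivity) fun j => ?_) hm
    exact abs_hilbertCurve_sub_le_of_le h m hle (by linarith) j
  rcases le_total x y with hle | hle
  · exact key x y hle hxy
  · rw [dist_comm] at hxy ⊢
    exact key y x hle hxy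

theorem measurable_hilbertCurve (h : IsHilbertOrder d cell) : Measurable (hilbertCurve d cell) :=
  (uniformContinuous_hilbertCurve h).continuous.measurable

/-- The map between the positions of the cubes in time and in space. -/
def cellMap (h : IsHilbertOrder d cell) (m : ℕ) (k : Fin (2 ^ (d * m))) (j : Fin d) : Fin (2 ^ m) :=
  ⟨cell m k j, (h.bijOn m).mapsTo k.isLt j⟩

theorem bijective_cellMap (h : IsHilbertOrder d cell) (m : ℕ) : Function.Bijective (cellMap h m) := by
  constructor
  · intro k k' e
    refine Fin.ext ((h.bijOn m).injOn k.isLt k'.isLt (funext fun j => ?_))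
    exact Fin.ext_iff.1 (congrFun e j)
  · intro c
    obtain ⟨k, hk, e⟩ := (h.bijOn m).surjOn (show (fun j => (c j : ℕ)) ∈ _ from fun j => (c j).isLt)
    exact ⟨⟨k, hk⟩, funext fun j => Fin.ext (congrFun e j)⟩

/-- The uniform distribution on the unit cube. -/
noncomputable def unifCube (d : ℕ) : Measure (EuclideanSpace ℝ (Fin d)) :=
  (Measure.pi fun _ : Fin d => unif).map (WithLp.toLp 2)

theorem measurable_toLp (d : ℕ) : Measurable (WithLp.toLp 2 : (Fin d → ℝ) → EuclideanSpace ℝ (Fin d)) :=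
  (PiLp.continuous_toLp 2 fun _ : Fin d => ℝ).measurable

instance (d : ℕ) : IsProbabilityMeasure (unifCube d) :=
  Measure.isProbabilityMeasure_map (measurable_toLp d).aemeasurable

theorem measurableSet_unitCube (d : ℕ) : MeasurableSet (unitCube d) := by
  have : unitCube d = ⋂ j, {x | x j ∈ Set.Icc (0 : ℝ) 1} := by ext; simp [unitCube]
  rw [this]
  exact MeasurableSet.iInter fun j => (EuclideanSpace.proj (𝕜 := ℝ) j).continuous.measurable measurableSet_Icc

theorem unifCube_eq (d : ℕ) : unifCube d = volume.restrict (unitCube d) := by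
  have h1 := (PiLp.volume_preserving_toLp (Fin d)).restrict_preimage (measurableSet_unitCube d)
  rw [← h1.map_eq, unifCube]
  congr 1
  have h2 : (WithLp.toLp 2 : (Fin d → ℝ) → EuclideanSpace ℝ (Fin d)) ⁻¹' unitCube d =
      Set.univ.pi fun _ => Set.Icc (0 : ℝ) 1 := by
    ext v
    simp only [Set.mem_preimage, unitCube, Set.mem_ofPred_eq, Set.mem_univ_pi]
  rw [h2, volume_pi, Measure.restrict_pi_pi]
  rfl

/-- The Hilbert curve preserves the measure. -/
theorem map_hilbertCurve (h : IsHilbertOrder d cell) : unif.map (hilbertCurve d cell) = unifCube d := by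
  have hHm := measurable_hilbertCurve h
  have : IsProbabilityMeasure (unif.map (hilbertCurve d cell)) :=
    Measure.isProbabilityMeasure_map hHm.aemeasurable
  refine ext_of_forall_integral_eq_of_IsFiniteMeasure fun φ => ?_
  have hφ : Measurable φ := φ.continuous.measurable
  rw [unifCube, integral_map hHm.aemeasurable hφ.aestronglyMeasurable,
    integral_map (measurable_toLp d).aemeasurable hφ.aestronglyMeasurable]
  let pt : (m : ℕ) → (Fin d → Fin (2 ^ m)) → EuclideanSpace ℝ (Fin d) := fun m c =>
    WithLp.toLp 2 fun j => ((c j : ℝ) + 1 / 2) / 2 ^ m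
  have hax (m : ℕ) (x : ℝ) : approxCurve d cell m x = pt m (cellMap h m (slot (2 ^ (d * m)) x)) := by
    simp [approxCurve, pt, cellMap, val_slot_eq_timeIndex]
  -- Both sides are the plain average of φ over the centres of the cubes of level m: the curve
  -- spends equal time at each centre, and a uniform point of the cube is equally likely to lie in
  -- each cell.
  have e1 (m : ℕ) : ∫ x, φ (approxCurve d cell m x) ∂unif =
      ∫ v, φ (pt m fun j => slot (2 ^ m) (v j)) ∂(Measure.pi fun _ : Fin d => unif) := by
    simp_rw [hax]
    rw [integral_slot (fun k => φ (pt m (cellMap h m k))), integral_slot_pi (fun c => φ (pt m c)),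
      (bijective_cellMap h m).sum_comp (fun c => φ (pt m c))]
    congr 2
    push_cast
    rw [← pow_mul, mul_comm]
  have l1 : Tendsto (fun m => ∫ x, φ (approxCurve d cell m x) ∂unif) atTop
      (𝓝 (∫ x, φ (hilbertCurve d cell x) ∂unif)) := by
    refine tendsto_integral_of_dominated_convergence (fun _ => ‖φ‖) (fun m => ?_)
      (integrable_const _) (fun m => ae_of_all _ fun x => φ.norm_coe_le_norm _)
      (ae_of_all _ fun x => (φ.continuous.tendsto _).comp (tendsto_approxCurve h x))
    simp_rw [hax]
    exact ((measurable_of_finite fun k => φ (pt m (cellMap h m k))).comp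
      (measurable_slot _)).aestronglyMeasurable
  have l2 : Tendsto (fun m => ∫ v, φ (pt m fun j => slot (2 ^ m) (v j))
      ∂(Measure.pi fun _ : Fin d => unif)) atTop
      (𝓝 (∫ v, φ (WithLp.toLp 2 v) ∂(Measure.pi fun _ : Fin d => unif))) := by
    have hae : ∀ᵐ v ∂(Measure.pi fun _ : Fin d => unif), ∀ j, v j ∈ Set.Ioo (0 : ℝ) 1 :=
      ae_all_iff.2 fun j => (Measure.tendsto_eval_ae_ae (i := j)).eventually ae_unif_mem
    refine tendsto_integral_of_dominated_convergence (fun _ => ‖φ‖) (fun m => ?_)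
      (integrable_const _) (fun m => ae_of_all _ fun x => φ.norm_coe_le_norm _) ?_
    · have hm : Measurable fun (v : Fin d → ℝ) j => slot (2 ^ m) (v j) :=
        measurable_pi_lambda _ fun j => (measurable_slot _).comp (measurable_pi_apply j)
      exact ((measurable_of_finite fun c => φ (pt m c)).comp hm).aestronglyMeasurable
    · filter_upwards [hae] with v hv
      refine (φ.continuous.tendsto _).comp (((PiLp.continuous_toLp 2 fun _ : Fin d => ℝ).tendsto v).comp
        (tendsto_pi_nhds.2 fun j => ?_))
      have hp : Tendsto (fun m : ℕ => (1 : ℝ) / 2 ^ m) atTop (𝓝 0) :=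
        tendsto_const_nhds.div_atTop (tendsto_pow_atTop_atTop_of_one_lt (by norm_num))
      rw [tendsto_iff_norm_sub_tendsto_zero]
      refine squeeze_zero (fun _ => norm_nonneg _) (fun m => ?_) hp
      have hb := slot_bounds (2 ^ m) (Set.Ioo_subset_Icc_self (hv j))
      push_cast at hb
      have hp : (0 : ℝ) < 2 ^ m := by positivity
      rw [Real.norm_eq_abs, abs_le]
      have e2 : ((slot (2 ^ m) (v j) : ℝ) + 1 / 2) / 2 ^ m - v j =
        ((slot (2 ^ m) (v j) : ℝ) + 1 / 2 - 2 ^ m * v j) / 2 ^ m := by field_simp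
      rw [e2, ← neg_div]
      constructor
      · gcongr; linarith [hb.2]
      · gcongr; linarith [hb.1]
  simp_rw [e1] at l1
  exact tendsto_nhds_unique l1 l2

theorem integral_comp_hilbertCurve (h : IsHilbertOrder d cell) {φ : EuclideanSpace ℝ (Fin d) → ℝ}
    (hφ : AEStronglyMeasurable φ (unifCube d)) :
    ∫ x, φ (hilbertCurve d cell x) ∂unif = ∫ X in unitCube d, φ X := by
  rw [← unifCube_eq, ← map_hilbertCurve h, integral_map (measurable_hilbertCurve h).aemeasurable]
  rwa [map_hilbertCurve h]

/-- The point with relative position `v` in the dyadic cube of level `m` with lowest corner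
`2 ^ (-m) * c`. -/
noncomputable def cubePoint (m : ℕ) (c : Fin d → ℕ) (v : Fin d → ℝ) : EuclideanSpace ℝ (Fin d) :=
  WithLp.toLp 2 fun j => (c j + v j) / 2 ^ m

/-- The change of variables is a translation followed by a dilation. The cube is open because a
curve point in the interior of a cube determines its dyadic time interval, which fails on shared
faces. -/
theorem integral_openCube (m : ℕ) (c : Fin d → ℕ) (φ : EuclideanSpace ℝ (Fin d) → ℝ)
    (hφ : Measurable φ) :
    ∫ X in {X | ∀ j, X j ∈ Set.Ioo ((c j : ℝ) / 2 ^ m) ((c j + 1) / 2 ^ m)}, φ X =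
      ((2 : ℝ) ^ (d * m))⁻¹ * ∫ v, φ (cubePoint m c v) ∂(Measure.pi fun _ : Fin d => unif) := by
  set B := {X : EuclideanSpace ℝ (Fin d) | ∀ j, X j ∈ Set.Ioo ((c j : ℝ) / 2 ^ m) ((c j + 1) / 2 ^ m)}
    with hB
  have hp : (0 : ℝ) < 2 ^ m := by positivity
  have hBm : MeasurableSet B := by
    have : B = ⋂ j, {X | X j ∈ Set.Ioo ((c j : ℝ) / 2 ^ m) ((c j + 1) / 2 ^ m)} := by
      ext; simp [B]
    rw [this]
    exact MeasurableSet.iInter fun j =>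
      (EuclideanSpace.proj (𝕜 := ℝ) j).continuous.measurable measurableSet_Ioo
  let a : EuclideanSpace ℝ (Fin d) := WithLp.toLp 2 fun j => (c j : ℝ) / 2 ^ m
  rw [← integral_indicator hBm, ← integral_add_left_eq_self (B.indicator φ) a]
  have h1 := Measure.integral_comp_smul (volume : Measure (EuclideanSpace ℝ (Fin d)))
    (fun X => B.indicator φ (a + X)) ((2 : ℝ) ^ m)⁻¹
  rw [finrank_euclideanSpace_fin, abs_of_pos (by positivity), smul_eq_mul] at h1
  have h2 : ∫ X, B.indicator φ (a + X) = ((2 : ℝ) ^ (d * m))⁻¹ *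
      ∫ Z : EuclideanSpace ℝ (Fin d), B.indicator φ (a + ((2 : ℝ) ^ m)⁻¹ • Z) := by
    rw [h1, ← mul_assoc]
    have : ((2 : ℝ) ^ (d * m))⁻¹ * ((((2 : ℝ) ^ m)⁻¹ ^ d)⁻¹) = 1 := by
      rw [inv_pow, inv_inv, ← pow_mul, mul_comm m d]
      exact inv_mul_cancel₀ (by positivity)
    rw [this, one_mul]
  rw [h2]
  congr 1
  have h3 : ∫ v, φ (cubePoint m c v) ∂(Measure.pi fun _ : Fin d => unif) =
      ∫ Z, φ (a + ((2 : ℝ) ^ m)⁻¹ • Z) ∂(unifCube d) := by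
    have hm : Measurable fun Z => φ (a + ((2 : ℝ) ^ m)⁻¹ • Z) :=
      hφ.comp (measurable_const_add _ |>.comp (measurable_const_smul _))
    rw [unifCube, integral_map (measurable_toLp d).aemeasurable hm.aestronglyMeasurable]
    congr 1
    ext v
    congr 1
    ext j
    simp only [cubePoint, a, PiLp.add_apply, PiLp.smul_apply, smul_eq_mul]
    field_simp
  have h4 : ∀ᵐ Z ∂(unifCube d), ∀ j, Z j ∈ Set.Ioo (0 : ℝ) 1 := by
    have hae : ∀ᵐ v ∂(Measure.pi fun _ : Fin d => unif), ∀ j, v j ∈ Set.Ioo (0 : ℝ) 1 :=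
      ae_all_iff.2 fun j => (Measure.tendsto_eval_ae_ae (i := j)).eventually ae_unif_mem
    rw [unifCube, ae_map_iff (measurable_toLp d).aemeasurable]
    · exact hae
    · have : {Z : EuclideanSpace ℝ (Fin d) | ∀ j, Z j ∈ Set.Ioo (0 : ℝ) 1} =
        ⋂ j, {X | X j ∈ Set.Ioo (0 : ℝ) 1} := by ext; simp
      rw [this]
      exact MeasurableSet.iInter fun j =>
        (EuclideanSpace.proj (𝕜 := ℝ) j).continuous.measurable measurableSet_Ioo
  have hmem (Z : EuclideanSpace ℝ (Fin d)) : a + ((2 : ℝ) ^ m)⁻¹ • Z ∈ B ↔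
      ∀ j, Z j ∈ Set.Ioo (0 : ℝ) 1 := by
    refine forall_congr' fun j => ?_
    have e : (a + ((2 : ℝ) ^ m)⁻¹ • Z) j = (c j + Z j) / 2 ^ m := by
      simp only [a, PiLp.add_apply, PiLp.smul_apply, smul_eq_mul]
      field_simp
    rw [e, Set.mem_Ioo, Set.mem_Ioo, div_lt_div_iff_of_pos_right hp,
      div_lt_div_iff_of_pos_right hp]
    constructor <;> rintro ⟨h1, h2⟩ <;> constructor <;> linarith
  rw [h3, unifCube_eq, ← integral_indicator (measurableSet_unitCube d)]
  rw [unifCube_eq, ae_restrict_iff' (measurableSet_unitCube d)] at h4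
  refine integral_congr_ae ?_
  filter_upwards [h4] with Z hZ
  by_cases hZ1 : Z ∈ unitCube d
  · rw [Set.indicator_of_mem hZ1, Set.indicator_of_mem ((hmem Z).2 (hZ hZ1))]
  · rw [Set.indicator_of_notMem hZ1, Set.indicator_of_notMem]
    exact fun h5 => hZ1 fun j => Set.Ioo_subset_Icc_self ((hmem Z).1 h5 j)

/-- The Hilbert curve spends enough time in each dyadic cube while it passes it. -/
theorem integral_cube_le (h : IsHilbertOrder d cell) {φ : EuclideanSpace ℝ (Fin d) → ℝ}
    (hφ : Measurable φ) (h0 : ∀ X, 0 ≤ φ X) {M : ℝ} (hM : ∀ X, φ X ≤ M) {m k : ℕ}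
    (hk : k < 2 ^ (d * m)) :
    ((2 : ℝ) ^ (d * m))⁻¹ * ∫ v, φ (cubePoint m (cell m k) v) ∂(Measure.pi fun _ : Fin d => unif) ≤
      ∫ x in (k / (2 ^ (d * m) : ℕ) : ℝ)..((k + 1 : ℕ) / (2 ^ (d * m) : ℕ)),
        φ (hilbertCurve d cell x) := by
  rw [← integral_openCube _ _ _ hφ]
  set N := 2 ^ (d * m) with hN
  have hN0 : 0 < (N : ℝ) := by positivity
  set B := {X : EuclideanSpace ℝ (Fin d) | ∀ j, X j ∈
    Set.Ioo ((cell m k j : ℝ) / 2 ^ m) ((cell m k j + 1) / 2 ^ m)} with hB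
  have hBm : MeasurableSet B := by
    have : B = ⋂ j, {X | X j ∈ Set.Ioo ((cell m k j : ℝ) / 2 ^ m) ((cell m k j + 1) / 2 ^ m)} := by
      ext; simp [B]
    rw [this]
    exact MeasurableSet.iInter fun j =>
      (EuclideanSpace.proj (𝕜 := ℝ) j).continuous.measurable measurableSet_Ioo
  have hBc : B ⊆ unitCube d := by
    intro X hX j
    have hc : ((cell m k j : ℝ) + 1) / 2 ^ m ≤ 1 := by
      rw [div_le_one (by positivity)]
      exact_mod_cast (h.bijOn m).mapsTo hk j
    exact ⟨le_trans (by positivity) (hX j).1.le, (hX j).2.le.trans hc⟩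
  -- By measure preservation the integral over the open cube is an integral over the times at which
  -- the curve is in it. It remains to see that these times lie in the k-th dyadic interval; φ ≥ 0
  -- takes care of the rest of that interval.
  have e1 : ∫ X in B, φ X = ∫ x, B.indicator φ (hilbertCurve d cell x) ∂unif := by
    rw [integral_comp_hilbertCurve h (hφ.indicator hBm).aestronglyMeasurable,
      setIntegral_indicator hBm, Set.inter_eq_self_of_subset_right hBc]
  rw [e1]
  have hle : (k / N : ℝ) ≤ ((k + 1 : ℕ) / N) := by gcongr; simp
  have e2 : ∫ x in (k / N : ℝ)..((k + 1 : ℕ) / N), φ (hilbertCurve d cell x) =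
      ∫ x, (Set.Icc (k / N : ℝ) ((k + 1 : ℕ) / N)).indicator (fun x => φ (hilbertCurve d cell x)) x
        ∂unif := by
    rw [intervalIntegral.integral_of_le hle, ← integral_Icc_eq_integral_Ioc, unif,
      setIntegral_indicator measurableSet_Icc, Set.inter_eq_self_of_subset_right]
    exact Set.Icc_subset_Icc (by positivity) (stratum_le hk)
  rw [e2]
  have hφb (X : EuclideanSpace ℝ (Fin d)) : ‖φ X‖ ≤ M := by
    rw [Real.norm_of_nonneg (h0 X)]; exact hM X
  have hM0 : 0 ≤ M := (h0 0).trans (hM 0)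
  have hHm := measurable_hilbertCurve h
  refine integral_mono_ae ?_ ?_ ?_
  · refine Integrable.of_bound ((hφ.indicator hBm).comp hHm).aestronglyMeasurable M
      (ae_of_all _ fun x => ?_)
    exact (norm_indicator_le_norm_self _ _).trans (hφb _)
  · refine Integrable.of_bound ((hφ.comp hHm).indicator measurableSet_Icc).aestronglyMeasurable M
      (ae_of_all _ fun x => ?_)
    exact (norm_indicator_le_norm_self _ _).trans (hφb _)
  · filter_upwards [ae_unif_mem] with x hx
    by_cases hxB : hilbertCurve d cell x ∈ B
    -- The curve is also in the closed cube of its current cell. Closed and open dyadic cubes of one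
    -- level meet only if their integer corners agree.
    · have h1 : cell m (timeIndex d m x) = cell m k := by
        funext j
        have h2 := hilbertCurve_mem_cell h m x j
        have h3 := hxB j
        have h4 := h2.1.trans_lt h3.2
        have h5 := h3.1.trans_le h2.2
        rw [div_lt_div_iff_of_pos_right (by positivity)] at h4 h5
        have h6 : cell m (timeIndex d m x) j < cell m k j + 1 := by
          rw [← Nat.cast_lt (α := ℝ)]
          push_cast
          exact h4
        have h7 : cell m k j < cell m (timeIndex d m x) j + 1 := by
          rw [← Nat.cast_lt (α := ℝ)]
          push_cast
          exact h5
        omega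
      have h2 := (h.bijOn m).injOn (timeIndex_lt d m x) hk h1
      have h3 := slot_bounds N (Set.Ioo_subset_Icc_self hx)
      rw [val_slot_eq_timeIndex, h2] at h3
      rw [Set.indicator_of_mem hxB, Set.indicator_of_mem]
      refine ⟨by rw [div_le_iff₀ hN0]; linarith [h3.1], ?_⟩
      rw [le_div_iff₀ hN0]
      push_cast
      linarith [h3.2]
    · rw [Set.indicator_of_notMem hxB]
      exact Set.indicator_nonneg (fun _ _ => h0 _) _

end Geometry

/-! ### Mean square oscillation over cubes and over strata -/

section

theorem variance_id_unif : Var[fun x => x; unif] = 1 / 12 := by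
  have h1 : ∫ x, x ∂unif = 1 / 2 := by rw [integral_unif]; norm_num
  have h2 : ∫ x, x ^ 2 ∂unif = 1 / 3 := by rw [integral_unif]; norm_num
  have hm : MemLp (fun x : ℝ => x) 2 unif := by
    refine MemLp.of_bound measurable_id.aestronglyMeasurable 1 ?_
    filter_upwards [ae_unif_mem] with x hx
    rw [Real.norm_of_nonneg hx.1.le]
    exact hx.2.le
  rw [variance_eq_sub hm]
  simp only [Pi.pow_apply, h1, h2]
  norm_num

theorem memLp_mul_unif (a : ℝ) : MemLp (fun x : ℝ => a * x) 2 unif := by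
  refine MemLp.of_bound (measurable_const_mul a).aestronglyMeasurable |a| ?_
  filter_upwards [ae_unif_mem] with x hx
  rw [norm_mul, Real.norm_of_nonneg hx.1.le, Real.norm_eq_abs]
  exact mul_le_of_le_one_right (abs_nonneg _) hx.2.le

/-- The mean square deviation of a linear function on the unit cube from a constant. -/
theorem le_integral_linear_sub_sq {d : ℕ} (w : Fin d → ℝ) (c : ℝ) :
    (∑ j, w j ^ 2) / 12 ≤ ∫ v, (∑ j, w j * v j - c) ^ 2 ∂(Measure.pi fun _ : Fin d => unif) := by
  have h1 := variance_sum_pi (μ := fun _ : Fin d => unif) (X := fun j x => w j * x)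
    fun j => memLp_mul_unif (w j)
  have h2 (j : Fin d) : Var[fun x => w j * x; unif] = w j ^ 2 / 12 := by
    rw [variance_const_mul, variance_id_unif]
    ring
  simp_rw [h2] at h1
  rw [← Finset.sum_div] at h1
  have hm : Measurable fun v : Fin d → ℝ => ∑ j, w j * v j := by fun_prop
  have h3 : Var[fun v => ∑ j, w j * v j - c; Measure.pi fun _ : Fin d => unif] =
      (∑ j, w j ^ 2) / 12 := by
    rw [variance_sub_const hm.aestronglyMeasurable, ← h1]
    congr 1
    ext v
    simp
  rw [← h3]
  -- The variance is at most the second moment about any point, so the bound is uniform in c.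
  exact variance_le_expectation_sq (hm.sub_const c).aestronglyMeasurable

variable {d : ℕ}

theorem convex_box (a b : Fin d → ℝ) :
    Convex ℝ {X : EuclideanSpace ℝ (Fin d) | ∀ j, X j ∈ Set.Icc (a j) (b j)} := by
  have : {X : EuclideanSpace ℝ (Fin d) | ∀ j, X j ∈ Set.Icc (a j) (b j)} =
      ⋂ j, (EuclideanSpace.proj (𝕜 := ℝ) j).toLinearMap ⁻¹' Set.Icc (a j) (b j) := by
    ext; simp
  rw [this]
  exact convex_iInter fun j => (convex_Icc _ _).linear_preimage _

theorem isCompact_unitCube (d : ℕ) : IsCompact (unitCube d) := by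
  have h1 : IsCompact (Set.univ.pi fun _ : Fin d => Set.Icc (0 : ℝ) 1) :=
    isCompact_univ_pi fun _ => isCompact_Icc
  have h2 := h1.image (PiLp.continuous_toLp 2 fun _ : Fin d => ℝ)
  convert h2 using 1
  ext X
  simp only [unitCube, Set.mem_image, Set.mem_univ_pi]
  exact ⟨fun h => ⟨WithLp.ofLp X, h, rfl⟩, by rintro ⟨v, hv, rfl⟩; exact hv⟩

/-- A convex set with an interior point, here the centre, has unique derivatives. This makes
`fderivWithin` of a C¹ function continuous on the whole closed cube. -/
theorem uniqueDiffOn_unitCube (d : ℕ) : UniqueDiffOn ℝ (unitCube d) := by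
  refine uniqueDiffOn_convex (convex_box _ _) ⟨WithLp.toLp 2 fun _ => 1 / 2, ?_⟩
  have ho : IsOpen {X : EuclideanSpace ℝ (Fin d) | ∀ j, X j ∈ Set.Ioo (0 : ℝ) 1} := by
    simp only [Set.ofPred_forall]
    exact isOpen_iInter_of_finite fun j =>
      isOpen_Ioo.preimage (EuclideanSpace.proj (𝕜 := ℝ) j).continuous
  have hs : {X : EuclideanSpace ℝ (Fin d) | ∀ j, X j ∈ Set.Ioo (0 : ℝ) 1} ⊆ unitCube d :=
    fun X hX j => Set.Ioo_subset_Icc_self (hX j)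
  refine interior_maximal hs ho fun j => ?_
  norm_num

/-- The closed dyadic cube of level `m` with lowest corner `2 ^ (-m) * c`. -/
def dyadicCube (m : ℕ) (c : Fin d → ℕ) : Set (EuclideanSpace ℝ (Fin d)) :=
  {X | ∀ j, X j ∈ Set.Icc ((c j : ℝ) / 2 ^ m) ((c j + 1) / 2 ^ m)}

theorem dyadicCube_subset {m : ℕ} {c : Fin d → ℕ} (hc : ∀ j, c j < 2 ^ m) :
    dyadicCube m c ⊆ unitCube d := by
  intro X hX j
  refine ⟨le_trans (by positivity) (hX j).1, (hX j).2.trans ?_⟩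
  rw [div_le_one (by positivity)]
  exact_mod_cast hc j

theorem cubePoint_mem {m : ℕ} {c : Fin d → ℕ} {v : Fin d → ℝ} (hv : ∀ j, v j ∈ Set.Icc (0 : ℝ) 1) :
    cubePoint m c v ∈ dyadicCube m c := by
  intro j
  simp only [cubePoint]
  constructor
  · gcongr; linarith [(hv j).1]
  · gcongr; exact (hv j).2

theorem norm_sub_le_of_mem_dyadicCube {m : ℕ} {c : Fin d → ℕ} {X Y : EuclideanSpace ℝ (Fin d)}
    (hX : X ∈ dyadicCube m c) (hY : Y ∈ dyadicCube m c) : ‖X - Y‖ ≤ √d * (1 / 2 ^ m) := by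
  refine norm_le_of_abs_le (by positivity) fun j => ?_
  have h1 := hX j
  have h2 := hY j
  rw [add_div] at h1 h2
  rw [PiLp.sub_apply, abs_le]
  constructor <;> linarith [h1.1, h1.2, h2.1, h2.2]

theorem measurable_cubePoint (m : ℕ) (c : Fin d → ℕ) : Measurable (cubePoint m c) := by
  refine (measurable_toLp d).comp (measurable_pi_lambda _ fun j => ?_)
  fun_prop

theorem ae_unif_pi_mem :
    ∀ᵐ v ∂(Measure.pi fun _ : Fin d => unif), ∀ j, v j ∈ Set.Icc (0 : ℝ) 1 := by
  refine ae_all_iff.2 fun j => (Measure.tendsto_eval_ae_ae (i := j)).eventually ?_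
  filter_upwards [ae_unif_mem] with x hx using Set.Ioo_subset_Icc_self hx

/-- On a small cube a continuously differentiable function is not close to any constant. -/
theorem le_integral_cube_sub_sq {g φ : EuclideanSpace ℝ (Fin d) → ℝ}
    (hg : DifferentiableOn ℝ g (unitCube d)) (hφ : Measurable φ) {M : ℝ} (hM : ∀ X, |φ X| ≤ M)
    {m : ℕ} {c : Fin d → ℕ} (hc : ∀ j, c j < 2 ^ m) (hφg : ∀ X ∈ dyadicCube m c, φ X = g X)
    {L : EuclideanSpace ℝ (Fin d) →L[ℝ] ℝ} {ω : ℝ}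
    (hω : ∀ X ∈ dyadicCube m c, ‖fderivWithin ℝ g (unitCube d) X - L‖ ≤ ω) (c₀ : ℝ) :
    ((4 : ℝ) ^ m)⁻¹ * (3 / 40 * ‖L‖ ^ 2 - 9 * d * ω ^ 2) ≤
      ∫ v, (φ (cubePoint m c v) - c₀) ^ 2 ∂(Measure.pi fun _ : Fin d => unif) := by
  set X₀ := cubePoint m c fun _ => 0 with hX₀
  have hX₀m : X₀ ∈ dyadicCube m c := cubePoint_mem fun _ => by simp
  have hp : (0 : ℝ) < 2 ^ m := by positivity
  have h4 : ((4 : ℝ) ^ m)⁻¹ = (1 / 2 ^ m) ^ 2 := by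
    rw [div_pow, one_pow, ← pow_mul, mul_comm m 2, pow_mul]; norm_num
  set w := (InnerProductSpace.toDual ℝ (EuclideanSpace ℝ (Fin d))).symm L with hw
  have hwn : ‖L‖ ^ 2 = ∑ j, w j ^ 2 := by
    have : ‖w‖ = ‖L‖ := LinearIsometryEquiv.norm_map _ _
    rw [← this, EuclideanSpace.real_norm_sq_eq]
  have hL (Y : EuclideanSpace ℝ (Fin d)) : L Y = ∑ j, w j * Y j := by
    rw [← InnerProductSpace.toDual_symm_apply (𝕜 := ℝ), PiLp.inner_apply]
    simp [mul_comm, hw]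
  -- The affine approximation of g - c₀ on the cube, in relative coordinates; w is the vector that
  -- represents L.
  let u : (Fin d → ℝ) → ℝ := fun v => ∑ j, (w j * (1 / 2 ^ m)) * v j - (c₀ - g X₀)
  have hu (v : Fin d → ℝ) : u v = L (cubePoint m c v - X₀) + g X₀ - c₀ := by
    simp only [u, hL, hX₀, PiLp.sub_apply, cubePoint]
    have : ∀ j, w j * ((c j + v j) / 2 ^ m - (c j + 0) / 2 ^ m) = w j * (1 / 2 ^ m) * v j := by
      intro j; field_simp; ring
    simp_rw [this]
    ring
  have hum : Measurable u := by fun_prop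
  have hA : (1 / 2 ^ m) ^ 2 * ‖L‖ ^ 2 / 12 ≤ ∫ v, u v ^ 2 ∂(Measure.pi fun _ : Fin d => unif) := by
    refine le_trans (le_of_eq ?_) (le_integral_linear_sub_sq _ _)
    rw [hwn, Finset.mul_sum]
    congr 1
    exact Finset.sum_congr rfl fun j _ => by ring
  have hω0 : 0 ≤ ω := (norm_nonneg _).trans (hω X₀ hX₀m)
  have hpt : ∀ᵐ v ∂(Measure.pi fun _ : Fin d => unif),
      9 / 10 * u v ^ 2 - 9 * d * ω ^ 2 * (1 / 2 ^ m) ^ 2 ≤ (φ (cubePoint m c v) - c₀) ^ 2 := by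
    filter_upwards [ae_unif_pi_mem] with v hv
    have hX := cubePoint_mem (m := m) (c := c) hv
    -- The mean value inequality for g - L on the convex cube bounds the deviation from affinity by
    -- ω times the diameter.
    have h1 := Convex.norm_image_sub_le_of_norm_hasFDerivWithin_le' (f := g) (φ := L) (C := ω)
      (s := dyadicCube m c) (x := X₀) (y := cubePoint m c v)
      (fun X hX => ((hg X (dyadicCube_subset hc hX)).hasFDerivWithinAt).mono (dyadicCube_subset hc))
      hω (convex_box _ _) hX₀m hX
    have h2 := norm_sub_le_of_mem_dyadicCube hX hX₀m
    rw [hφg _ hX]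
    set η := g (cubePoint m c v) - g X₀ - L (cubePoint m c v - X₀) with hη
    have h3 : η ^ 2 ≤ d * ω ^ 2 * (1 / 2 ^ m) ^ 2 := by
      have h5 : |η| ≤ ω * (√d * (1 / 2 ^ m)) := h1.trans (by gcongr)
      have h6 := pow_le_pow_left₀ (abs_nonneg _) h5 2
      rw [sq_abs, mul_pow, mul_pow, Real.sq_sqrt (Nat.cast_nonneg d)] at h6
      linarith
    have h5 : g (cubePoint m c v) - c₀ = u v + η := by rw [hu, hη]; ring
    rw [h5]
    -- (u + η)² - (9/10 u² - 9 η²) = (u + 10 η)² / 10. The constant 3/40 of the statement is 9/10 ·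
    -- 1/12.
    nlinarith [sq_nonneg (u v + 10 * η)]
  have hb : ∃ C, ∀ᵐ v ∂(Measure.pi fun _ : Fin d => unif), ‖u v‖ ≤ C := by
    refine ⟨∑ j, |w j * (1 / 2 ^ m)| + |c₀ - g X₀|, ?_⟩
    filter_upwards [ae_unif_pi_mem] with v hv
    refine (norm_sub_le _ _).trans (add_le_add ?_ le_rfl)
    refine (norm_sum_le _ _).trans (Finset.sum_le_sum fun j _ => ?_)
    rw [norm_mul, Real.norm_of_nonneg (hv j).1, Real.norm_eq_abs]
    exact mul_le_of_le_one_right (abs_nonneg _) (hv j).2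
  obtain ⟨C, hC⟩ := hb
  have hi1 : Integrable (fun v => u v ^ 2) (Measure.pi fun _ : Fin d => unif) := by
    refine Integrable.of_bound (hum.pow_const 2).aestronglyMeasurable (C ^ 2) ?_
    filter_upwards [hC] with v hv
    rw [norm_pow]
    exact pow_le_pow_left₀ (norm_nonneg _) hv 2
  have hi2 : Integrable (fun v => (φ (cubePoint m c v) - c₀) ^ 2)
      (Measure.pi fun _ : Fin d => unif) := by
    refine Integrable.of_bound (((hφ.comp (measurable_cubePoint m c)).sub_const c₀).pow_const
      2).aestronglyMeasurable ((M + |c₀|) ^ 2) (ae_of_all _ fun v => ?_)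
    rw [norm_pow]
    refine pow_le_pow_left₀ (norm_nonneg _) ((norm_sub_le _ _).trans ?_) 2
    exact add_le_add (hM _) le_rfl
  calc ((4 : ℝ) ^ m)⁻¹ * (3 / 40 * ‖L‖ ^ 2 - 9 * d * ω ^ 2)
      = 9 / 10 * ((1 / 2 ^ m) ^ 2 * ‖L‖ ^ 2 / 12) - 9 * d * ω ^ 2 * (1 / 2 ^ m) ^ 2 := by
        rw [h4]; ring
    _ ≤ 9 / 10 * ∫ v, u v ^ 2 ∂(Measure.pi fun _ : Fin d => unif) -
          9 * d * ω ^ 2 * (1 / 2 ^ m) ^ 2 := by gcongr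
    _ = ∫ v, (9 / 10 * u v ^ 2 - 9 * d * ω ^ 2 * (1 / 2 ^ m) ^ 2)
          ∂(Measure.pi fun _ : Fin d => unif) := by
        rw [integral_sub (hi1.const_mul _) (integrable_const _), integral_const_mul]
        simp
    _ ≤ _ := integral_mono_ae ((hi1.const_mul _).sub (integrable_const _)) hi2 hpt

variable {cell : ℕ → ℕ → Fin d → ℕ}

theorem integrable_comp_hilbertCurve (h : IsHilbertOrder d cell)
    {φ : EuclideanSpace ℝ (Fin d) → ℝ} (hφ : Measurable φ) {M : ℝ} (hM : ∀ X, |φ X| ≤ M) :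
    Integrable (fun x => φ (hilbertCurve d cell x)) unif :=
  Integrable.of_bound (hφ.comp (measurable_hilbertCurve h)).aestronglyMeasurable M
    (ae_of_all _ fun _ => hM _)

/-- The dyadic time intervals inside an interval of at least twice their length fill more than a
third of it. -/
theorem le_integral_stratum (h : IsHilbertOrder d cell) {φ : EuclideanSpace ℝ (Fin d) → ℝ}
    (hφ : Measurable φ) (h0 : ∀ X, 0 ≤ φ X) {M : ℝ} (hM : ∀ X, φ X ≤ M) {n k m : ℕ}
    (hk : k < n) (hnm : 2 * n ≤ 2 ^ (d * m)) {β : ℝ}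
    (hβ : ∀ r : ℕ, r < 2 ^ (d * m) → (k / n : ℝ) ≤ r / (2 ^ (d * m) : ℕ) →
      (((r + 1 : ℕ) : ℝ) / (2 ^ (d * m) : ℕ)) ≤ ((k + 1 : ℕ) : ℝ) / n →
      β ≤ ∫ v, φ (cubePoint m (cell m r) v) ∂(Measure.pi fun _ : Fin d => unif)) :
    β / (3 * n) ≤ ∫ x in (k / n : ℝ)..((k + 1 : ℕ) / n), φ (hilbertCurve d cell x) := by
  have hn : 0 < n := by omega
  have hn' : 0 < (n : ℝ) := by exact_mod_cast hn
  have hle : (k / n : ℝ) ≤ ((k + 1 : ℕ) / n) := by gcongr; simp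
  rcases lt_or_ge β 0 with hβ0 | hβ0
  · refine le_trans (div_nonpos_of_nonpos_of_nonneg hβ0.le (by positivity)) ?_
    exact intervalIntegral.integral_nonneg hle fun x _ => h0 _
  have hint := integrable_comp_hilbertCurve h hφ (M := M)
    fun X => by rw [abs_of_nonneg (h0 X)]; exact hM X
  have hN2 : ((2 ^ (d * m) : ℕ) : ℝ) = (2 : ℝ) ^ (d * m) := by push_cast; rfl
  have hcube (r : ℕ) (hr : r < 2 ^ (d * m)) := integral_cube_le h hφ h0 hM hr
  rw [← hN2] at hcube
  set N := 2 ^ (d * m) with hN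
  have hN0 : 0 < (N : ℝ) := by positivity
  -- a is kN/n rounded up and e is (k+1)N/n rounded down, so the dyadic intervals with a ≤ r < e are
  -- exactly those inside the stratum.
  set a := (k * N + (n - 1)) / n with ha
  set e := ((k + 1) * N) / n with he
  have ha1 : k * N ≤ a * n := by
    have := Nat.lt_div_mul_add hn (a := k * N + (n - 1))
    rw [← ha] at this
    omega
  have ha2 : a * n < k * N + n := by
    have := Nat.div_mul_le_self (k * N + (n - 1)) n
    rw [← ha] at this
    omega
  have he1 : e * n ≤ (k + 1) * N := Nat.div_mul_le_self _ _
  have he2 : (k + 1) * N < e * n + n := Nat.lt_div_mul_add hn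
  have hae : a < e := by
    by_contra hcon
    have : e * n ≤ a * n := Nat.mul_le_mul_right _ (by omega)
    rw [add_mul] at he2
    omega
  -- Rounding loses less than one interval at each end: N < (e - a) n + 2n. Since e - a ≥ 1, the
  -- loss 2n is at most 2 (e - a) n.
  have hcount : N ≤ 3 * ((e - a) * n) := by
    obtain ⟨t, ht⟩ : ∃ t, e = a + 1 + t := ⟨e - a - 1, by omega⟩
    have e3 : e - a = t + 1 := by omega
    have e4 : e * n = a * n + n + t * n := by rw [ht]; ring
    have e5 : (t + 1) * n = t * n + n := by ring
    rw [add_mul] at he2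
    rw [e3]
    omega
  have heN : e ≤ N := by
    refine Nat.div_le_of_le_mul ?_
    exact Nat.mul_le_mul_right _ hk
  have hlow (r : ℕ) (hr : r ∈ Finset.Ico a e) :
      (N : ℝ)⁻¹ * β ≤ ∫ x in (r / N : ℝ)..((r + 1 : ℕ) / N), φ (hilbertCurve d cell x) := by
    rw [Finset.mem_Ico] at hr
    refine le_trans ?_ (hcube r (by omega))
    refine mul_le_mul_of_nonneg_left (hβ r (by omega) ?_ ?_) (by positivity)
    · rw [div_le_div_iff₀ hn' hN0]
      exact_mod_cast ha1.trans (Nat.mul_le_mul_right _ hr.1)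
    · rw [div_le_div_iff₀ hN0 hn']
      exact_mod_cast (Nat.mul_le_mul_right _ hr.2).trans he1
  have hsum : ∑ r ∈ Finset.Ico a e, ∫ x in (r / N : ℝ)..((r + 1 : ℕ) / N),
      φ (hilbertCurve d cell x) = ∫ x in (a / N : ℝ)..(e / N), φ (hilbertCurve d cell x) := by
    refine intervalIntegral.sum_integral_adjacent_intervals_Ico (a := fun r : ℕ => (r / N : ℝ))
      hae.le fun r hr => ?_
    refine intervalIntegrable_of_unif hint (by positivity) (by gcongr; simp) (stratum_le ?_)
    exact lt_of_lt_of_le hr.2 heN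
  calc β / (3 * n) ≤ ((e - a : ℕ) : ℝ) * ((N : ℝ)⁻¹ * β) := by
        have : (N : ℝ) ≤ 3 * ((e - a : ℕ) * n) := by exact_mod_cast hcount
        rw [div_le_iff₀ (by positivity)]
        calc β = (N : ℝ) * ((N : ℝ)⁻¹ * β) := by field_simp
          _ ≤ (3 * ((e - a : ℕ) * n)) * ((N : ℝ)⁻¹ * β) := by gcongr
          _ = _ := by ring
    _ = ∑ r ∈ Finset.Ico a e, (N : ℝ)⁻¹ * β := by simp
    _ ≤ _ := Finset.sum_le_sum hlow
    _ = ∫ x in (a / N : ℝ)..(e / N), φ (hilbertCurve d cell x) := hsum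
    _ ≤ _ := by
      refine intervalIntegral.integral_mono_interval ?_ (by gcongr) ?_
        (ae_of_all _ fun x => h0 _) (intervalIntegrable_of_unif hint (by positivity) hle (stratum_le hk))
      · rw [div_le_div_iff₀ hn' hN0]; exact_mod_cast ha1
      · rw [div_le_div_iff₀ hN0 hn']; exact_mod_cast he1

end

/-! ### The lower bound for the variance -/

section

theorem measurable_indicator_of_continuousOn {α : Type*} [TopologicalSpace α] [MeasurableSpace α]
    [OpensMeasurableSpace α] {f : α → ℝ} {s : Set α} (hf : ContinuousOn f s)
    (hs : MeasurableSet s) : Measurable (s.indicator f) := by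
  classical
  rw [← Set.piecewise_eq_indicator]
  exact hf.measurable_piecewise continuousOn_const hs

theorem variance_stratum {F : ℝ → ℝ} (hF : Measurable F) {n : ℕ} (hn : 0 < n) (k : ℕ) :
    Var[fun v => F ((k + v) / n); unif] = n * ∫ x in (k / n : ℝ)..((k + 1 : ℕ) / n),
      (F x - ∫ v, F ((k + v) / n) ∂unif) ^ 2 := by
  have hm : Measurable fun v : ℝ => F ((k + v) / n) := hF.comp (by fun_prop)
  rw [variance_eq_integral hm.aemeasurable,
    integral_unif_stratum (fun x => (F x - ∫ v, F ((k + v) / n) ∂unif) ^ 2) hn, smul_eq_mul]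

/-- If the square of the deviation from any constant, integrated over the strata, dominates `Φ`,
then so does the variance of the stratified mean. -/
theorem integral_le_variance_stratifiedMean {F : ℝ → ℝ} (hF : Measurable F) {M : ℝ}
    (hM : ∀ x, |F x| ≤ M) {n : ℕ} (hn : 0 < n) {Φ : ℝ → ℝ} (hΦ : Integrable Φ unif) {A : ℝ}
    (h : ∀ k < n, ∀ y ∈ Set.Icc (k / n : ℝ) ((k + 1 : ℕ) / n), ∀ c : ℝ,
      Φ y ≤ A * n * ∫ x in (k / n : ℝ)..((k + 1 : ℕ) / n), (F x - c) ^ 2) :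
    ∫ y, Φ y ∂unif ≤ A * n * Var[stratifiedMean F n; Measure.pi fun _ => unif] := by
  have hn' : 0 < (n : ℝ) := by exact_mod_cast hn
  have hvar := variance_stratifiedMean hF hM hn
  simp_rw [variance_stratum hF hn] at hvar
  rw [← Finset.sum_range fun k => (n : ℝ) * ∫ x in (k / n : ℝ)..((k + 1 : ℕ) / n),
      (F x - ∫ v, F ((k + v) / n) ∂unif) ^ 2, ← Finset.mul_sum, pow_two, mul_assoc] at hvar
  have hvar' := mul_left_cancel₀ hn'.ne' hvar
  rw [mul_assoc, hvar', integral_unif_eq_sum_strata hΦ hn, Finset.mul_sum]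
  refine Finset.sum_le_sum fun k hk => ?_
  rw [Finset.mem_range] at hk
  have hle : (k / n : ℝ) ≤ ((k + 1 : ℕ) / n) := by gcongr; simp
  have hlen : ((k + 1 : ℕ) / n : ℝ) - k / n = 1 / n := by push_cast; ring
  set c := ∫ v, F ((k + v) / n) ∂unif
  -- The bound for Φ y does not depend on y, so integration over the stratum multiplies it by 1/n.
  -- With c the stratum mean, the result is the contribution of the stratum to the variance.
  calc ∫ y in (k / n : ℝ)..((k + 1 : ℕ) / n), Φ y
      ≤ ∫ _ in (k / n : ℝ)..((k + 1 : ℕ) / n),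
          A * n * ∫ x in (k / n : ℝ)..((k + 1 : ℕ) / n), (F x - c) ^ 2 := by
        refine intervalIntegral.integral_mono_on hle
          (intervalIntegrable_of_unif hΦ (by positivity) hle (stratum_le hk))
          intervalIntegrable_const fun y hy => h k hk y hy c
    _ = A * ∫ x in (k / n : ℝ)..((k + 1 : ℕ) / n), (F x - c) ^ 2 := by
        rw [intervalIntegral.integral_const, hlen, smul_eq_mul]
        field_simp

/-- The least level whose intervals are at most half as long as a stratum: the level before it
fails, and one step multiplies the number of intervals by 2^d. -/
theorem exists_level {d n : ℕ} (hd : 1 ≤ d) (hn : 0 < n) :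
    ∃ m, 2 * n ≤ 2 ^ (d * m) ∧ 2 ^ (d * m) < 2 ^ (d + 1) * n := by
  classical
  have hex : ∃ m, 2 * n ≤ 2 ^ (d * m) := by
    refine ⟨2 * n, (Nat.lt_two_pow_self (n := 2 * n)).le.trans ?_⟩
    exact Nat.pow_le_pow_right (by norm_num) (Nat.le_mul_of_pos_left _ hd)
  refine ⟨Nat.find hex, Nat.find_spec hex, ?_⟩
  have h0 : Nat.find hex ≠ 0 := by
    intro h
    have := Nat.find_spec hex
    rw [h] at this
    simp at this
    omega
  obtain ⟨p, hp⟩ := Nat.exists_eq_succ_of_ne_zero h0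
  have h1 := Nat.find_min hex (m := p) (by omega)
  rw [hp, Nat.succ_eq_add_one, mul_add, mul_one, pow_add, pow_succ 2 d]
  have h2 : 2 ^ (d * p) < 2 * n := by omega
  calc 2 ^ (d * p) * 2 ^ d < 2 * n * 2 ^ d := Nat.mul_lt_mul_of_pos_right h2 (by positivity)
    _ = _ := by ring

/-- The hypothesis is raised to the power 2/d; this is the source of the exponent 2/d in the rate.
-/
theorem four_pow_le {d n m : ℕ} (hd : 1 ≤ d) (h : 2 ^ (d * m) < 2 ^ (d + 1) * n) :
    (4 : ℝ) ^ m ≤ 4 * (2 : ℝ) ^ (2 / (d : ℝ)) * (n : ℝ) ^ (2 / (d : ℝ)) := by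
  have hd' : (d : ℝ) ≠ 0 := by positivity
  have h1 : ((2 : ℝ) ^ (d * m)) ≤ 2 ^ (d + 1) * n := by exact_mod_cast h.le
  have h2 : ((2 : ℝ) ^ (d * m)) ^ (2 / (d : ℝ)) = 4 ^ m := by
    rw [← Real.rpow_natCast, ← Real.rpow_mul (by norm_num)]
    have : ((d * m : ℕ) : ℝ) * (2 / (d : ℝ)) = ((2 * m : ℕ) : ℝ) := by
      push_cast; field_simp
    rw [this, Real.rpow_natCast, pow_mul]
    norm_num
  have h3 : ((2 : ℝ) ^ (d + 1)) ^ (2 / (d : ℝ)) = 4 * 2 ^ (2 / (d : ℝ)) := by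
    rw [← Real.rpow_natCast, ← Real.rpow_mul (by norm_num)]
    have : ((d + 1 : ℕ) : ℝ) * (2 / (d : ℝ)) = 2 + 2 / d := by
      push_cast; field_simp
    rw [this, Real.rpow_add (by norm_num)]
    norm_num
  rw [← h2, ← h3, ← Real.mul_rpow (by positivity) (by positivity)]
  exact Real.rpow_le_rpow (by positivity) h1 (by positivity)

variable {d : ℕ} {cell : ℕ → ℕ → Fin d → ℕ}

theorem hilbertCurve_mem_dyadicCube (h : IsHilbertOrder d cell) {m r : ℕ} (hr : r < 2 ^ (d * m)) :
    hilbertCurve d cell (r / (2 ^ (d * m) : ℕ)) ∈ dyadicCube m (cell m r) := by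
  have h1 : timeIndex d m (r / (2 ^ (d * m) : ℕ)) = r := by
    have := slot_stratum (N := 2 ^ (d * m)) hr (v := 0) (by simp)
    rw [add_zero] at this
    rw [← val_slot_eq_timeIndex, this]
  intro j
  have h2 := hilbertCurve_mem_cell h m (r / (2 ^ (d * m) : ℕ)) j
  rw [h1] at h2
  exact h2

/-- The variance of the stratified mean is bounded below by the squared gradient, integrated over a
compact part of the domain. -/
theorem integral_gradient_le_variance (hd : 1 ≤ d) (h : IsHilbertOrder d cell)
    {U K : Set (EuclideanSpace ℝ (Fin d))} (hU : IsOpen U) (hUc : U ⊆ unitCube d)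
    (hK : IsCompact K) (hKU : K ⊆ U) {g : EuclideanSpace ℝ (Fin d) → ℝ}
    (hg : ContDiffOn ℝ 1 g (unitCube d)) {ω : ℝ} (hω : 0 < ω) :
    ∀ᶠ n : ℕ in atTop, ∀ m, 2 * n ≤ 2 ^ (d * m) →
      ∫ X in K, (3 / 40 * ‖fderivWithin ℝ g (unitCube d) X‖ ^ 2 - 9 * d * ω ^ 2) ≤
        3 * 4 ^ m * n *
          Var[stratifiedMean (fun x => U.indicator g (hilbertCurve d cell x)) n;
            Measure.pi fun _ => unif] := by
  set D := fderivWithin ℝ g (unitCube d) with hD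
  have hDc : ContinuousOn D (unitCube d) :=
    hg.continuousOn_fderivWithin (uniqueDiffOn_unitCube d) le_rfl
  have hKc : K ⊆ unitCube d := hKU.trans hUc
  obtain ⟨M, hM⟩ := (isCompact_unitCube d).exists_bound_of_continuousOn hg.continuousOn
  have hM0 : 0 ≤ M := (norm_nonneg _).trans
    (hM (hilbertCurve d cell 0) (hilbertCurve_mem_unitCube h 0))
  set φ := U.indicator g with hφdef
  have hφ : Measurable φ :=
    measurable_indicator_of_continuousOn (hg.continuousOn.mono hUc) hU.measurableSet
  have hφM (X : EuclideanSpace ℝ (Fin d)) : |φ X| ≤ M := by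
    by_cases hX : X ∈ U
    · rw [hφdef, Set.indicator_of_mem hX]; exact hM X (hUc hX)
    · rw [hφdef, Set.indicator_of_notMem hX, abs_zero]; exact hM0
  set Γ : EuclideanSpace ℝ (Fin d) → ℝ :=
    K.indicator fun X => 3 / 40 * ‖D X‖ ^ 2 - 9 * d * ω ^ 2 with hΓdef
  have hΓc : ContinuousOn (fun X => 3 / 40 * ‖D X‖ ^ 2 - 9 * d * ω ^ 2) K :=
    (((hDc.mono hKc).norm.pow 2).const_smul (3 / 40 : ℝ)).sub continuousOn_const
  have hΓ : Measurable Γ := measurable_indicator_of_continuousOn hΓc hK.measurableSet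
  obtain ⟨B, hB⟩ := hK.exists_bound_of_continuousOn hΓc
  have hΓB (X : EuclideanSpace ℝ (Fin d)) : |Γ X| ≤ max B 0 := by
    by_cases hX : X ∈ K
    · rw [hΓdef, Set.indicator_of_mem hX]; exact (hB X hX).trans (le_max_left _ _)
    · rw [hΓdef, Set.indicator_of_notMem hX, abs_zero]; exact le_max_right _ _
  have hΓint : ∫ X in K, (3 / 40 * ‖D X‖ ^ 2 - 9 * d * ω ^ 2) =
      ∫ y, Γ (hilbertCurve d cell y) ∂unif := by
    rw [integral_comp_hilbertCurve h hΓ.aestronglyMeasurable, hΓdef,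
      setIntegral_indicator hK.measurableSet, Set.inter_eq_self_of_subset_right hKc]
  rw [hΓint]
  obtain ⟨ρ₁, hρ₁, hKρ⟩ := hK.exists_cthickening_subset_open hU hKU
  obtain ⟨ρ₂, hρ₂, hDρ⟩ := Metric.uniformContinuousOn_iff.1
    ((isCompact_unitCube d).uniformContinuousOn_of_continuous hDc) ω hω
  -- Within distance ρ of a point of K one is still in U, where the indicator is inactive; and
  -- between points of the unit cube at distance less than ρ the derivative changes by less than ω.
  set ρ := min ρ₁ ρ₂ with hρ
  have hρ0 : 0 < ρ := lt_min hρ₁ hρ₂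
  obtain ⟨τ, hτ, hHτ⟩ := Metric.uniformContinuous_iff.1 (uniformContinuous_hilbertCurve h)
    (ρ / 2) (by positivity)
  have hlim1 : Tendsto (fun n : ℕ => (1 : ℝ) / n) atTop (𝓝 0) := tendsto_one_div_atTop_nhds_zero_nat
  have hlim2 : Tendsto (fun p : ℕ => √d * (1 / 2 ^ p)) atTop (𝓝 0) := by
    have : Tendsto (fun p : ℕ => (1 : ℝ) / 2 ^ p) atTop (𝓝 0) :=
      tendsto_const_nhds.div_atTop (tendsto_pow_atTop_atTop_of_one_lt (by norm_num))
    simpa using this.const_mul (√d)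
  -- The distance ρ is split in two: ρ/2 for the movement of the curve during a stratum (1/n < τ),
  -- and ρ/2 for the diameter of a cube of level m ≥ p.
  obtain ⟨p, hp⟩ := (hlim2.eventually_lt_const (show (0 : ℝ) < ρ / 2 by positivity)).exists
  filter_upwards [hlim1.eventually_lt_const hτ, eventually_ge_atTop (2 ^ (d * p)),
    eventually_gt_atTop 0] with n hnτ hnp hn m hm
  have hpm : p ≤ m := by
    by_contra hcon
    have : 2 ^ (d * m) ≤ 2 ^ (d * p) :=
      Nat.pow_le_pow_right (by norm_num) (Nat.mul_le_mul_left _ (by omega))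
    omega
  have hside : √d * (1 / 2 ^ m) < ρ / 2 := by
    refine lt_of_le_of_lt ?_ hp
    gcongr
    norm_num
  have hn' : 0 < (n : ℝ) := by exact_mod_cast hn
  refine integral_le_variance_stratifiedMean (F := fun x => φ (hilbertCurve d cell x)) (hφ.comp (measurable_hilbertCurve h))
    (fun x => hφM _) hn (integrable_comp_hilbertCurve h hΓ hΓB) fun k hk y hy c => ?_
  have hle : (k / n : ℝ) ≤ ((k + 1 : ℕ) / n) := by gcongr; simp
  by_cases hyK : hilbertCurve d cell y ∈ K
  swap
  · simp only [hΓdef, Set.indicator_of_notMem hyK]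
    have : 0 ≤ ∫ x in (k / n : ℝ)..((k + 1 : ℕ) / n),
        (φ (hilbertCurve d cell x) - c) ^ 2 :=
      intervalIntegral.integral_nonneg hle fun x _ => sq_nonneg _
    positivity
  simp only [hΓdef, Set.indicator_of_mem hyK]
  set Y := hilbertCurve d cell y with hY
  -- The derivative is frozen at Y = H(y): every cube swept out during the stratum of y stays within
  -- ρ of Y ∈ K.
  have hmain := le_integral_stratum h (φ := fun X => (φ X - c) ^ 2) ((hφ.sub_const c).pow_const 2)
    (fun X => sq_nonneg _) (M := (M + |c|) ^ 2) (fun X => ?_) hk hm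
    (β := ((4 : ℝ) ^ m)⁻¹ * (3 / 40 * ‖D Y‖ ^ 2 - 9 * d * ω ^ 2)) fun r hr h1 h2 => ?_
  · rw [div_le_iff₀ (by positivity), inv_mul_le_iff₀ (by positivity)] at hmain
    refine hmain.trans (le_of_eq ?_)
    ring
  · rw [← sq_abs]
    exact pow_le_pow_left₀ (abs_nonneg _) ((abs_sub _ _).trans (add_le_add (hφM X) le_rfl)) 2
  · have hclose : ∀ X ∈ dyadicCube m (cell m r), dist X Y < ρ := by
      intro X hX
      set t : ℝ := r / (2 ^ (d * m) : ℕ)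
      have h3 := norm_sub_le_of_mem_dyadicCube hX (hilbertCurve_mem_dyadicCube h hr)
      rw [← dist_eq_norm] at h3
      have h4 : dist t y < τ := by
        refine lt_of_le_of_lt ?_ hnτ
        have e1 : ((k + 1 : ℕ) / n : ℝ) = k / n + 1 / n := by push_cast; ring
        have e2 : t ≤ ((r + 1 : ℕ) : ℝ) / (2 ^ (d * m) : ℕ) := by
          simp only [t]; gcongr; simp
        have hy1 := hy.1
        have hy2 := hy.2
        rw [e1] at hy2 h2
        rw [Real.dist_eq, abs_le]
        constructor <;> linarith
      have h5 := hHτ h4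
      calc dist X Y ≤ dist X (hilbertCurve d cell t) + dist (hilbertCurve d cell t) Y :=
            dist_triangle _ _ _
        _ < ρ := by linarith
    have hc : ∀ j, cell m r j < 2 ^ m := (h.bijOn m).mapsTo hr
    refine le_integral_cube_sub_sq (hg.differentiableOn one_ne_zero) hφ hφM hc (fun X hX => ?_)
      (fun X hX => ?_) c
    · refine Set.indicator_of_mem (hKρ ?_) g
      exact Metric.mem_cthickening_of_dist_le X Y ρ₁ K hyK
        ((hclose X hX).le.trans (min_le_left _ _))
    · have := hDρ X (dyadicCube_subset hc hX) Y (hKc hyK)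
        ((hclose X hX).trans_le (min_le_right _ _))
      rw [dist_eq_norm] at this
      exact this.le

theorem volume_unitCube (d : ℕ) : volume (unitCube d) = 1 := by
  have : unifCube d Set.univ = 1 := measure_univ
  rwa [unifCube_eq, Measure.restrict_apply_univ] at this

/-- The lower bound for the variance of the stratified mean. -/
theorem eventually_le_variance_stratifiedMean (hd : 1 ≤ d) (h : IsHilbertOrder d cell)
    {U : Set (EuclideanSpace ℝ (Fin d))} (hU : IsOpen U) (hUc : U ⊆ unitCube d)
    {g : EuclideanSpace ℝ (Fin d) → ℝ} (hg : ContDiffOn ℝ 1 g (unitCube d)) {σsq : ℝ}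
    (hσ : σsq = ∫ X in U, ‖fderivWithin ℝ g (unitCube d) X‖ ^ 2) (hpos : 0 < σsq) :
    ∀ᶠ n : ℕ in atTop, σsq / 96 * (2 : ℝ) ^ (-(2 / (d : ℝ)) - (d : ℝ)) *
      (n : ℝ) ^ (-1 - 2 / (d : ℝ)) ≤
        Var[stratifiedMean (fun x => U.indicator g (hilbertCurve d cell x)) n;
          Measure.pi fun _ => unif] := by
  have hd' : 0 < (d : ℝ) := by exact_mod_cast hd
  set D := fderivWithin ℝ g (unitCube d) with hD
  have hDc : ContinuousOn (fun X => ‖D X‖ ^ 2) (unitCube d) :=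
    (hg.continuousOn_fderivWithin (uniqueDiffOn_unitCube d) le_rfl).norm.pow 2
  obtain ⟨C, hC⟩ := (isCompact_unitCube d).exists_bound_of_continuousOn hDc
  have hC0 : 0 ≤ C := (norm_nonneg _).trans
    (hC (hilbertCurve d cell 0) (hilbertCurve_mem_unitCube h 0))
  have hUfin : volume U ≠ ⊤ :=
    ((measure_mono hUc).trans_lt (by rw [volume_unitCube]; simp)).ne
  have hi : IntegrableOn (fun X => ‖D X‖ ^ 2) U :=
    (hDc.integrableOn_compact (isCompact_unitCube d)).mono_set hUc
  -- K then loses at most σ²/20 of the gradient integral; C + 1 avoids a zero denominator.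
  set ε : ℝ := σsq / (20 * (C + 1)) with hε
  have hε0 : 0 < ε := by positivity
  obtain ⟨K, hKU, hK, hKε⟩ := hU.measurableSet.exists_isCompact_sdiff_lt hUfin
    (ε := ENNReal.ofReal ε) (by simpa using hε0)
  have hKc := hKU.trans hUc
  have hKvol : volume.real K ≤ 1 := by
    have : volume K ≤ 1 := (measure_mono hKc).trans (volume_unitCube d).le
    exact ENNReal.toReal_le_of_le_ofReal zero_le_one (by simpa using this)
  have hsplit : ∫ X in U, ‖D X‖ ^ 2 = (∫ X in K, ‖D X‖ ^ 2) + ∫ X in U \ K, ‖D X‖ ^ 2 := by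
    rw [← setIntegral_union Set.disjoint_sdiff_right (hU.measurableSet.diff hK.measurableSet)
      (hi.mono_set hKU) (hi.mono_set Set.sdiff_subset), Set.union_sdiff_cancel hKU]
  have hdiff : ∫ X in U \ K, ‖D X‖ ^ 2 ≤ σsq / 20 := by
    have h1 : volume.real (U \ K) ≤ ε :=
      ENNReal.toReal_le_of_le_ofReal hε0.le hKε.le
    calc ∫ X in U \ K, ‖D X‖ ^ 2 ≤ ‖∫ X in U \ K, ‖D X‖ ^ 2‖ := Real.le_norm_self _
      _ ≤ C * volume.real (U \ K) :=
        norm_setIntegral_le_of_norm_le_const (hKε.trans (by simp)) fun X hX => hC X (hUc hX.1)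
      _ ≤ (C + 1) * ε := by gcongr; linarith
      _ = σsq / 20 := by rw [hε]; field_simp
  set ω : ℝ := √(σsq / (1800 * d)) with hω
  have hω0 : 0 < ω := Real.sqrt_pos.2 (by positivity)
  have hω2 : 9 * d * ω ^ 2 = σsq / 200 := by
    rw [hω, Real.sq_sqrt (by positivity)]; field_simp; norm_num
  -- The numbers: 3/40 · 19/20 - 1/200 = 53/800, which exceeds 1/16 = 50/800.
  have hKint : σsq / 16 ≤ ∫ X in K, (3 / 40 * ‖D X‖ ^ 2 - 9 * d * ω ^ 2) := by
    have hKfin : volume K ≠ ⊤ := hK.measure_lt_top.ne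
    rw [integral_sub ((hi.mono_set hKU).const_mul _) (integrableOn_const hKfin), integral_const_mul,
      setIntegral_const, smul_eq_mul, hω2]
    have h2 : volume.real K * (σsq / 200) ≤ 1 * (σsq / 200) := by gcongr
    linarith
  filter_upwards [integral_gradient_le_variance hd h hU hUc hK hKU hg hω0, eventually_gt_atTop 0]
    with n hn hn0
  obtain ⟨m, hm1, hm2⟩ := exists_level hd hn0
  have hn1 := hKint.trans (hn m hm1)
  have hn' : 0 < (n : ℝ) := by exact_mod_cast hn0
  set V := Var[stratifiedMean (fun x => U.indicator g (hilbertCurve d cell x)) n;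
    Measure.pi fun _ => unif] with hV
  have hV0 : 0 ≤ V := variance_nonneg _ _
  have h4 := four_pow_le hd hm2
  set a : ℝ := (2 : ℝ) ^ (2 / (d : ℝ)) with ha
  set b : ℝ := (n : ℝ) ^ (2 / (d : ℝ)) with hb
  have ha0 : 0 < a := by positivity
  have hb0 : 0 < b := by positivity
  have e1 : (2 : ℝ) ^ (-(2 / (d : ℝ)) - (d : ℝ)) = a⁻¹ * ((2 : ℝ) ^ d)⁻¹ := by
    rw [Real.rpow_sub (by norm_num), Real.rpow_neg (by norm_num), Real.rpow_natCast, div_eq_mul_inv]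
  have e2 : (n : ℝ) ^ (-1 - 2 / (d : ℝ)) = (n : ℝ)⁻¹ * b⁻¹ := by
    rw [Real.rpow_sub hn', Real.rpow_neg_one, div_eq_mul_inv]
  have h2d : (2 : ℝ) ≤ 2 ^ d := by
    calc (2 : ℝ) = 2 ^ 1 := by norm_num
      _ ≤ 2 ^ d := pow_le_pow_right₀ (by norm_num) hd
  have h5 : ((2 : ℝ) ^ d)⁻¹ ≤ 1 / 2 := by
    rw [inv_le_comm₀ (by positivity) (by norm_num)]
    linarith
  rw [e1, e2]
  -- The argument yields σ² / (192 a b n), that is, the factor 1/2 in place of 2^(-d).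
  calc σsq / 96 * (a⁻¹ * ((2 : ℝ) ^ d)⁻¹) * ((n : ℝ)⁻¹ * b⁻¹)
      ≤ σsq / 96 * (a⁻¹ * (1 / 2)) * ((n : ℝ)⁻¹ * b⁻¹) := by gcongr
    _ = (σsq / 16) / (12 * a * b * n) := by field_simp; norm_num
    _ ≤ V := by
      rw [div_le_iff₀ (by positivity)]
      calc σsq / 16 ≤ 3 * 4 ^ m * n * V := hn1
        _ ≤ 3 * (4 * a * b) * n * V := by gcongr
        _ = V * (12 * a * b * n) := by ring

end

/-! ### Null boundary, and transfer from the stratified mean to the estimate -/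

/-- The neighbourhoods contain A, and their volume is a convergent quotient times 2ε, hence tends to
0. -/
theorem volume_eq_zero_of_hasMinkowskiContent {d : ℕ} {A : Set (EuclideanSpace ℝ (Fin d))}
    (hA : HasMinkowskiContent A) : volume A = 0 := by
  obtain ⟨M, hM⟩ := hA
  have h1 : Tendsto (fun ε : ℝ => ENNReal.ofReal (2 * ε)) (𝓝[>] 0) (𝓝 0) := by
    have : Tendsto (fun ε : ℝ => ENNReal.ofReal (2 * ε)) (𝓝 0) (𝓝 (ENNReal.ofReal (2 * 0))) :=
      (ENNReal.continuous_ofReal.comp (continuous_const.mul continuous_id)).tendsto 0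
    simpa using this.mono_left nhdsWithin_le_nhds
  have h2 := ENNReal.Tendsto.mul hM (Or.inr (by simp)) h1 (Or.inr (by simp))
  rw [mul_zero] at h2
  refine le_antisymm (ge_of_tendsto h2 ?_) zero_le
  filter_upwards [self_mem_nhdsWithin] with ε (hε : 0 < ε)
  rw [ENNReal.div_mul_cancel (by simpa using hε) ENNReal.ofReal_ne_top]
  refine measure_mono fun x hx => ⟨x, hx, 0, by simpa using hε.le, by simp⟩

theorem measurable_stratifiedMean {F : ℝ → ℝ} (hF : Measurable F) (n : ℕ) :
    Measurable (stratifiedMean F n) := by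
  unfold stratifiedMean
  fun_prop

theorem memLp_stratifiedMean {F : ℝ → ℝ} (hF : Measurable F) {M : ℝ} (hM : ∀ x, |F x| ≤ M) (n : ℕ) :
    MemLp (stratifiedMean F n) 2 (Measure.pi fun _ => unif) := by
  refine MemLp.of_bound (measurable_stratifiedMean hF n).aestronglyMeasurable
    (1 / (n : ℝ) * ∑ _k : Fin n, M) (ae_of_all _ fun v => ?_)
  rw [stratifiedMean, norm_mul, Real.norm_of_nonneg (by positivity)]
  gcongr
  exact (norm_sum_le _ _).trans (Finset.sum_le_sum fun k _ => hM _)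

/-- Each sample point has a law absolutely continuous with respect to `unif`. The lemma allows f ∘
H, which need not be Borel measurable, to be replaced by a measurable function. -/
theorem stratifiedMean_congr_ae {F F' : ℝ → ℝ} (h : F =ᵐ[unif] F') (n : ℕ) :
    stratifiedMean F n =ᵐ[Measure.pi fun _ => unif] stratifiedMean F' n := by
  have h1 : ∀ᵐ v ∂(Measure.pi fun _ : Fin n => unif), ∀ k : Fin n,
      F ((k + v k) / n) = F' ((k + v k) / n) :=
    ae_all_iff.2 fun k =>
      (Measure.quasiMeasurePreserving_eval (fun _ : Fin n => unif) k).ae (ae_unif_stratum h k.isLt)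
  filter_upwards [h1] with v hv
  simp only [stratifiedMean, hv]

/-- The exponents add up to 1 - 2/d, which is positive precisely because d > 2. -/
theorem tendsto_sq_mul_variance {c : ℝ} (hc : 0 < c) {d : ℕ} (hd : 2 < d) {N : ℕ → ℕ} {V : ℕ → ℝ}
    (hN : Tendsto N atTop atTop)
    (h : ∀ᶠ m in atTop, c * (N m : ℝ) ^ (-1 - 2 / (d : ℝ)) ≤ V m) :
    Tendsto (fun m => (N m : ℝ) ^ 2 * V m) atTop atTop := by
  have hd' : (2 : ℝ) < d := by exact_mod_cast hd
  have hexp : 0 < 1 - 2 / (d : ℝ) := by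
    rw [sub_pos, div_lt_one (by linarith)]
    exact hd'
  have h1 : Tendsto (fun m => c * (N m : ℝ) ^ (1 - 2 / (d : ℝ))) atTop atTop :=
    ((tendsto_rpow_atTop hexp).comp (tendsto_natCast_atTop_atTop.comp hN)).const_mul_atTop hc
  refine tendsto_atTop_mono' _ ?_ h1
  filter_upwards [h, hN.eventually_gt_atTop 0] with m hm hm0
  have hm' : 0 < (N m : ℝ) := by exact_mod_cast hm0
  calc c * (N m : ℝ) ^ (1 - 2 / (d : ℝ))
      = (N m : ℝ) ^ 2 * (c * (N m : ℝ) ^ (-1 - 2 / (d : ℝ))) := by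
        rw [mul_left_comm, ← Real.rpow_natCast (N m : ℝ) 2, ← Real.rpow_add hm']
        congr 2
        push_cast
        ring
    _ ≤ _ := by gcongr

end HSFC

theorem mainTheorem2 {d b : ℕ} [NeZero b] (hd : 1 ≤ d) (hb : 2 ≤ b)
    (cell : ℕ → ℕ → Fin d → ℕ) (hcell : HSFC.IsHilbertOrder d cell)
    {S : Type*} [MeasurableSpace S] (P : Measure S) [IsProbabilityMeasure P]
    (π : List (Fin b) → S → Equiv.Perm (Fin b)) (hπ : HSFC.IsUniformScrambling P π)
    (Ω : Set (EuclideanSpace ℝ (Fin d))) (hΩ : Ω ⊆ HSFC.unitCube d)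
    (hcontent : HSFC.HasMinkowskiContent (frontier Ω))
    (g : EuclideanSpace ℝ (Fin d) → ℝ) (hg : ContDiffOn ℝ 1 g (HSFC.unitCube d))
    (σsq : ℝ) (hσsq : σsq = ∫ X in Ω, ‖gradientWithin g (HSFC.unitCube d) X‖ ^ 2)
    (hσpos : 0 < σsq)
    (f : EuclideanSpace ℝ (Fin d) → ℝ) (hf : f = Ω.indicator g) :
    (∀ m : ℕ, MemLp (HSFC.estimate cell π f (b ^ m)) 2 P) ∧
    (∀ᶠ m : ℕ in atTop,
      σsq / 96 * (2 : ℝ) ^ (-(2 / (d : ℝ)) - (d : ℝ)) *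
          ((b ^ m : ℕ) : ℝ) ^ (-1 - 2 / (d : ℝ)) ≤
        Var[HSFC.estimate cell π f (b ^ m); P]) ∧
    (2 < d →
      TendstoInDistribution
        (fun (m : ℕ) (s : S) =>
          (HSFC.estimate cell π f (b ^ m) s - ∫ X in HSFC.unitCube d, f X) /
            √(Var[HSFC.estimate cell π f (b ^ m); P]))
        atTop (id : ℝ → ℝ) (fun _ => P) (gaussianReal 0 1)) := by
  open HSFC in
  -- Ω itself may fail to be Borel. Its interior is open and differs from it by a null set, so
  -- neither σ² nor, almost surely, the estimate is affected.
  set U := interior Ω with hUdef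
  have hUc : U ⊆ unitCube d := interior_subset.trans hΩ
  have hnull : volume (frontier Ω) = 0 := volume_eq_zero_of_hasMinkowskiContent hcontent
  have hσ : σsq = ∫ X in U, ‖fderivWithin ℝ g (unitCube d) X‖ ^ 2 := by
    rw [hσsq, setIntegral_congr_set (interior_ae_eq_of_null_frontier hnull).symm]
    simp [gradientWithin, hUdef]
  set φ := U.indicator g with hφdef
  have hφ : Measurable φ :=
    measurable_indicator_of_continuousOn (hg.continuousOn.mono hUc) isOpen_interior.measurableSet
  obtain ⟨M, hM⟩ := (isCompact_unitCube d).exists_bound_of_continuousOn hg.continuousOn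
  have hM0 : 0 ≤ M := (norm_nonneg _).trans
    (hM (hilbertCurve d cell 0) (hilbertCurve_mem_unitCube hcell 0))
  have hφM (X : EuclideanSpace ℝ (Fin d)) : |φ X| ≤ M := by
    by_cases hX : X ∈ U
    · rw [hφdef, Set.indicator_of_mem hX]; exact hM X (hUc hX)
    · rw [hφdef, Set.indicator_of_notMem hX, abs_zero]; exact hM0
  have hfφ : f =ᵐ[volume] φ := by
    rw [hf]
    exact (indicator_ae_eq_of_ae_eq_set (interior_ae_eq_of_null_frontier hnull)).symm
  set F : ℝ → ℝ := fun x => φ (hilbertCurve d cell x) with hFdef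
  have hF : Measurable F := hφ.comp (measurable_hilbertCurve hcell)
  have hFM (x : ℝ) : |F x| ≤ M := hφM _
  have hfF : (fun x => f (hilbertCurve d cell x)) =ᵐ[unif] F := by
    have h1 : f =ᵐ[unif.map (hilbertCurve d cell)] φ := by
      rw [map_hilbertCurve hcell, unifCube_eq]
      exact ae_restrict_of_ae hfφ
    exact ae_of_ae_map (measurable_hilbertCurve hcell).aemeasurable h1
  have hmean : ∫ X in unitCube d, f X = ∫ x, F x ∂unif := by
    rw [hFdef, integral_comp_hilbertCurve hcell hφ.aestronglyMeasurable]
    exact integral_congr_ae (ae_restrict_of_ae hfφ)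
  let W : (m : ℕ) → S → Fin (b ^ m) → ℝ := fun m s k =>
    offset π m ((stratumPerm π m s).symm k) s
  have hW (m : ℕ) : MeasurePreserving (W m) P (Measure.pi fun _ => unif) :=
    hπ.measurePreserving_offset hb m
  have hest (m : ℕ) : estimate cell π f (b ^ m) =ᵐ[P] stratifiedMean F (b ^ m) ∘ W m := by
    filter_upwards [(hW m).quasiMeasurePreserving.ae (stratifiedMean_congr_ae hfF (b ^ m))] with s hs
    rw [estimate_eq_stratifiedMean]
    exact hs
  have hvar (m : ℕ) : Var[estimate cell π f (b ^ m); P] =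
      Var[stratifiedMean F (b ^ m); Measure.pi fun _ => unif] := by
    rw [variance_congr (hest m), ← (hW m).map_eq, variance_map _ (hW m).measurable.aemeasurable]
    exact (measurable_stratifiedMean hF _).aemeasurable
  have hbm : Tendsto (fun m => b ^ m) atTop atTop := tendsto_pow_atTop_atTop_of_one_lt (by omega)
  have hlower := hbm.eventually (eventually_le_variance_stratifiedMean hd hcell
    isOpen_interior hUc hg hσ hσpos)
  refine ⟨fun m => ?_, ?_, fun hd2 => ?_⟩
  · exact (memLp_congr_ae (hest m)).2
      ((memLp_stratifiedMean hF hFM _).comp_measurePreserving (hW m))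
  · filter_upwards [hlower] with m hm
    rw [hvar]
    exact hm
  · have hmeas (m : ℕ) : AEMeasurable (estimate cell π f (b ^ m)) P :=
      ((measurable_stratifiedMean hF _).comp (hW m).measurable).aemeasurable.congr (hest m).symm
    refine ⟨fun m => ((hmeas m).sub_const _).div_const _, aemeasurable_id, ?_⟩
    refine ProbabilityMeasure.tendsto_iff_tendsto_charFun.2 fun t => ?_
    have hinf := tendsto_sq_mul_variance (c := σsq / 96 * (2 : ℝ) ^ (-(2 / (d : ℝ)) - (d : ℝ)))
      (by positivity) hd2 hbm hlower
    have hclt := tendsto_charFun_stratifiedMean hF hFM (N := fun m => b ^ m)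
      (fun m => by positivity) (fun _ => rfl) hinf t
    -- The mean and the variance agree on both sides, so the standardised variables have the same
    -- law and the limit theorem for stratified means applies.
    have hlaw (m : ℕ) : P.map (fun s => (estimate cell π f (b ^ m) s - ∫ X in unitCube d, f X) /
        √(Var[estimate cell π f (b ^ m); P])) = (Measure.pi fun _ : Fin (b ^ m) => unif).map
          fun v => (stratifiedMean F (b ^ m) v - ∫ x, F x ∂unif) /
            √(Var[stratifiedMean F (b ^ m); Measure.pi fun _ => unif]) := by
      rw [← (hW m).map_eq, Measure.map_map _ (hW m).measurable, (hW m).map_eq, hvar, hmean]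
      · refine Measure.map_congr ?_
        filter_upwards [hest m] with s hs
        rw [hs]
        rfl
      · exact ((measurable_stratifiedMean hF _).sub_const _).div_const _
    simp only [ProbabilityMeasure.coe_mk, hlaw, Measure.map_id]
    exact hclt
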